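/- **Corollary 4.4.** Let $q$ be a complex number with $|q|<1$. Write $(a;q)_n=\prod_{i=0}^{n-1}(1-aq^i)$, $(a;q)_\infty=\prod_{i\ge 0}(1-aq^i)$, $(a,b,c;q)_\infty=(a;q)_\infty(b;q)_\infty(c;q)_\infty$, and $1/(q;q)_n=0$ for integers $n<0$. Let $k\ge 0$ be an integer, and for non-negative integers $s_1,\dots,s_{k+1}$ put $s_i=0$ for $i\ge k+2$ and $$E_0=s_1^2+s_2^2+s_2+\sum_{i=3}^{k+1}2^{i-3}s_i .$$ For an integer $E$ depending on $s_1,\dots,s_{k+1}$ put $$S(E)=\sum_{s_1,\dots,s_{k+1}\ge 0}\frac{q^{E}}{(q;q)_{s_1-s_2}}\prod_{i=3}^{k+2}\frac{(-q^{2^{i-3}};q^{2^{i-3}})_{2s_i}}{(q^{2^{i-2}};q^{2^{i-2}})_{s_{i-1}-s_i}} .$$ 1. For every integer $j$ with $1\le j\le k$, the series $S(E_0-2^{j-1}s_{j+1})$ converges absolutely and $$S\bigl(E_0-2^{j-1}s_{j+1}\bigr)=\frac{(q^{2^k+4},\,q^{2^{j-1}+2},\,q^{2^k-2^{j-1}+2};\,q^{2^k+4})_\infty}{(q;q)_\infty}.$$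 If moreover $j<k$, this equals $\sum_{n\ge 0}p(n)q^n$, where $p(n)$ is the number of partitions of $n$ with no part congruent to $0$ or $\pm(2+2^{j-1})$ modulo $2^k+4$. 2. The series $S(E_0)$ converges absolutely, and $$S(E_0)=\frac{(q^{2^k+4},\,q^{2},\,q^{2^k+2};\,q^{2^k+4})_\infty}{(q;q)_\infty}=\sum_{n\ge0}p(n)q^n,$$ where $p(n)$ is the number of partitions of $n$ with no part congruent to $0$ or $\pm2$ modulo $2^k+4$. 3. The series $S(E_0+s_1)$ converges absolutely, and $$S(E_0+s_1)=\frac{(q^{2^k+4},\,q,\,q^{2^k+3};\,q^{2^k+4})_\infty}{(q;q)_\infty}=\sum_{n\ge0}p(n)q^n,$$ where $p(n)$ is the number of partitions of $n$ with no part congruent to $0$ or $\pm1$ modulo $2^k+4$. The power series $\sum_{n\ge0} p(n)q^n$ above also converge absolutely. -/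

import Mathlib

namespace RogersRamanujan

/-- The finite `q`-shifted factorial `(a;q)_n = (1 - a)(1 - aq) ⋯ (1 - aq^{n-1})`. -/
noncomputable def qPoch (a q : ℂ) (n : ℕ) : ℂ :=
  ∏ i ∈ Finset.range n, (1 - a * q ^ i)

/-- The infinite `q`-shifted factorial `(a;q)_∞ = ∏_{i ≥ 0} (1 - aq^i)`
(the product converges absolutely for `|q| < 1`). -/
noncomputable def qPochInf (a q : ℂ) : ℂ :=
  ∏' i : ℕ, (1 - a * q ^ i)

/-- The reciprocal `1 / (q;q)_n` for an integer `n`, with the usual convention that it is `0`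
for negative `n`. -/
noncomputable def qFactInv (q : ℂ) (n : ℤ) : ℂ :=
  if 0 ≤ n then 1 / qPoch q q n.toNat else 0

/-- The summation index `s_i`, counted from `1`, of a tuple `(s_1, …, s_{k+1})`; it is `0`
for `i > k + 1` (in particular `s_{k+2} = 0`). -/
def idx {k : ℕ} (s : Fin (k + 1) → ℕ) (i : ℕ) : ℕ :=
  if h : 1 ≤ i ∧ i ≤ k + 1 then s ⟨i - 1, by omega⟩ else 0

/-- The exponent `s_1² + s_2² + s_2 + s_3 + 2 s_4 + ⋯ + 2^{k-2} s_{k+1}`. -/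
def baseExponent {k : ℕ} (s : Fin (k + 1) → ℕ) : ℤ :=
  (idx s 1 : ℤ) ^ 2 + (idx s 2 : ℤ) ^ 2 + (idx s 2 : ℤ)
    + ∑ i ∈ Finset.Icc 3 (k + 1), 2 ^ (i - 3) * (idx s i : ℤ)

/-- The summand of the multisum with exponent `E = e`:
`q^e / (q;q)_{s_1-s_2} · ∏_{i=3}^{k+2}
  (-q^{2^{i-3}};q^{2^{i-3}})_{2 s_i} / (q^{2^{i-2}};q^{2^{i-2}})_{s_{i-1}-s_i}`. -/
noncomputable def summand {k : ℕ} (q : ℂ) (e : ℤ) (s : Fin (k + 1) → ℕ) : ℂ :=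
  q ^ e * qFactInv q ((idx s 1 : ℤ) - (idx s 2 : ℤ)) *
    ∏ i ∈ Finset.Icc 3 (k + 2),
      (qPoch (-(q ^ (2 ^ (i - 3)))) (q ^ (2 ^ (i - 3))) (2 * idx s i) *
        qFactInv (q ^ (2 ^ (i - 2))) ((idx s (i - 1) : ℤ) - (idx s i : ℤ)))

/-- The quotient `(q^M, q^c, q^d; q^M)_∞ / (q;q)_∞`. -/
noncomputable def thetaQuotient (q : ℂ) (M c d : ℕ) : ℂ :=
  qPochInf (q ^ M) (q ^ M) * qPochInf (q ^ c) (q ^ M) * qPochInf (q ^ d) (q ^ M) / qPochInf q q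

/-- The number of partitions of `n` no part of which is congruent to `0` or `±c` modulo `M`. -/
def countAvoiding (M c n : ℕ) : ℕ :=
  (Nat.Partition.restricted n fun m =>
    ¬ ((m : ℤ) ≡ 0 [ZMOD M]) ∧ ¬ ((m : ℤ) ≡ c [ZMOD M]) ∧ ¬ ((m : ℤ) ≡ -c [ZMOD M])).card

end RogersRamanujan

namespace RogersRamanujan

open Finset

/-! ### Finite `q`-shifted factorials -/

/-! The proof is Bailey's method. A pair relative to `q ^ e` satisfies `β_n = ∑ α_r / ((q;q)_{n-r}
(q;q)_{n+r+e})`, and this kernel is reproduced by two kinds of finite sums. The standard step keeps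
the base and multiplies `α_r` by `q ^ (r² + e r)` (`sum_vandermonde`). The quadratic step passes
from base `q²` to base `q`; it leaves `α_r` alone for `e = 0` (`sum_changeOfBase_one`) and
multiplies it by `q ^ r / (1 + q ^ (2r+1))` for `e = 1` (`sum_changeOfBase_self`).

Take the unit pair in base `q ^ 2 ^ k`, where `β_n` is `1` at `n = 0` and `0` elsewhere. Apply `k`
quadratic steps and then two standard steps, letting `n → ∞` in the last (`hasSum_of_chain`). The
`β` side unfolds into the multisum, and the `α` side is a theta series summed by
`jacobi_triple_product`. The choice `e = 0` gives `S(E_0)`, and `e = 1` gives `S(E_0 + s_1)`. For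
`S(E_0 - 2^{j-1} s_{j+1})` the chain with `e = 0` is twisted once, in base `q ^ 2 ^ (j-1)`:
multiplying `β_n` there by that base to the power `-n` multiplies `α_r` by its `r`-th power
(`hasSum_triTerm_twist`).

Absolute convergence holds because the `q`-factorials are bounded and the exponent is at least
`s_1²` on nonincreasing tuples, the only ones that contribute. The partition series come from
comparing finite Euler products with nonnegative coefficients (`hasSum_card_restricted`). -/

lemma qPoch_zero (a q : ℂ) : qPoch a q 0 = 1 := by simp [qPoch]

lemma qPoch_succ (a q : ℂ) (n : ℕ) : qPoch a q (n + 1) = qPoch a q n * (1 - a * q ^ n) := by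
  simp [qPoch, prod_range_succ]

lemma one_sub_pow_ne_zero {q : ℂ} (hq : ‖q‖ < 1) {n : ℕ} (hn : n ≠ 0) : 1 - q ^ n ≠ 0 := by
  intro h
  have h1 : ‖q ^ n‖ = 1 := by rw [← sub_eq_zero.mp h]; simp
  rw [norm_pow] at h1
  exact (pow_lt_one₀ (norm_nonneg _) hq hn).ne h1

lemma one_add_pow_ne_zero {q : ℂ} (hq : ‖q‖ < 1) {n : ℕ} (hn : n ≠ 0) : 1 + q ^ n ≠ 0 := by
  intro h
  have h1 : ‖q ^ n‖ = 1 := by rw [eq_neg_of_add_eq_zero_right h]; simp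
  rw [norm_pow] at h1
  exact (pow_lt_one₀ (norm_nonneg _) hq hn).ne h1

lemma norm_pow_lt_one {q : ℂ} (hq : ‖q‖ < 1) {n : ℕ} (hn : n ≠ 0) : ‖q ^ n‖ < 1 := by
  rw [norm_pow]; exact pow_lt_one₀ (norm_nonneg _) hq hn

lemma qPoch_self_ne_zero {q : ℂ} (hq : ‖q‖ < 1) (n : ℕ) : qPoch q q n ≠ 0 := by
  refine prod_ne_zero_iff.mpr fun i _ => ?_
  rw [← pow_succ']
  exact one_sub_pow_ne_zero hq (by omega)

/-- The reciprocal of `(q;q)_n` for a natural number `n`. -/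
noncomputable def recip (q : ℂ) (n : ℕ) : ℂ := (qPoch q q n)⁻¹

lemma recip_zero (q : ℂ) : recip q 0 = 1 := by simp [recip, qPoch]

lemma recip_succ {q : ℂ} (hq : ‖q‖ < 1) (n : ℕ) :
    (1 - q ^ (n + 1)) * recip q (n + 1) = recip q n := by
  have h1 := qPoch_self_ne_zero hq n
  have h2 := one_sub_pow_ne_zero hq (Nat.succ_ne_zero n)
  rw [recip, recip, qPoch_succ, ← pow_succ']
  field_simp

lemma qFactInv_natCast (q : ℂ) (n : ℕ) : qFactInv q n = recip q n := by
  simp [qFactInv, recip]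

lemma qFactInv_of_neg (q : ℂ) {n : ℤ} (hn : n < 0) : qFactInv q n = 0 := by
  simp [qFactInv, hn]

lemma qFactInv_sub_natCast (q : ℂ) {m n : ℕ} (h : m ≤ n) :
    qFactInv q ((n : ℤ) - m) = recip q (n - m) := by
  rw [← Nat.cast_sub h, qFactInv_natCast]

lemma qFactInv_sub_natCast_of_lt (q : ℂ) {m n : ℕ} (h : n < m) :
    qFactInv q ((n : ℤ) - m) = 0 := qFactInv_of_neg q (by omega)

/-- At `m = 0` the factor `1 - q ^ 0` matches the convention `1 / (q;q)_{-1} = 0`. As the recurrence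
holds for all integers, reflections of bilateral sums create no boundary terms. -/
lemma one_sub_zpow_mul_qFactInv {q : ℂ} (hq : ‖q‖ < 1) (m : ℤ) :
    (1 - q ^ m) * qFactInv q m = qFactInv q (m - 1) := by
  rcases lt_trichotomy m 0 with h | rfl | h
  · rw [qFactInv_of_neg q h, qFactInv_of_neg q (by omega), mul_zero]
  · rw [qFactInv_of_neg q (by omega : (0 : ℤ) - 1 < 0)]; simp
  · obtain ⟨n, rfl⟩ : ∃ n : ℕ, m = ((n + 1 : ℕ) : ℤ) := ⟨m.toNat - 1, by omega⟩
    rw [zpow_natCast, qFactInv_natCast, recip_succ hq,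
      show (((n + 1 : ℕ) : ℤ) - 1) = (n : ℤ) by push_cast; ring, qFactInv_natCast]

/-! ### Finite summation formulas -/

lemma sum_one_sub_pow_mul_recip_left {q : ℂ} (hq : ‖q‖ < 1) (N : ℕ) (v : ℕ → ℂ) :
    ∑ m ∈ range (N + 2), (1 - q ^ (N + 1 - m)) * recip q (N + 1 - m) * v m =
      ∑ m ∈ range (N + 1), recip q (N - m) * v m := by
  rw [sum_range_succ]
  simp only [Nat.sub_self, pow_zero, sub_self, zero_mul, add_zero]
  refine sum_congr rfl fun m hm => ?_
  rw [show N + 1 - m = N - m + 1 by have := mem_range.mp hm; omega, recip_succ hq]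

lemma sum_one_sub_pow_mul_recip_right {q : ℂ} (hq : ‖q‖ < 1) (N : ℕ) (v : ℕ → ℂ) :
    ∑ m ∈ range (N + 2), (1 - q ^ m) * recip q m * v m =
      ∑ m ∈ range (N + 1), recip q m * v (m + 1) := by
  rw [sum_range_succ']
  simp [recip_succ hq]

/-- The `q`-Pascal rule, first form. -/
lemma pascal_left {q : ℂ} (hq : ‖q‖ < 1) (N : ℕ) (v : ℕ → ℂ) :
    (1 - q ^ (N + 1)) * ∑ m ∈ range (N + 2), recip q (N + 1 - m) * recip q m * v m =
      ∑ m ∈ range (N + 1), recip q (N - m) * recip q m * v m +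
      ∑ m ∈ range (N + 1), recip q (N - m) * recip q m * (q ^ (N - m) * v (m + 1)) := by
  have h1 := sum_one_sub_pow_mul_recip_left hq N fun m => recip q m * v m
  have h2 := sum_one_sub_pow_mul_recip_right hq N
    fun m => recip q (N + 1 - m) * q ^ (N + 1 - m) * v m
  simp only [mul_assoc, Nat.add_sub_add_right] at h1 h2 ⊢
  rw [← h1, mul_sum]
  have h3 : ∑ m ∈ range (N + 1), recip q (N - m) * (recip q m * (q ^ (N - m) * v (m + 1))) =
      ∑ m ∈ range (N + 1), recip q m * (recip q (N - m) * (q ^ (N - m) * v (m + 1))) :=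
    sum_congr rfl fun m _ => by ring
  rw [h3, ← h2, ← sum_add_distrib]
  refine sum_congr rfl fun m hm => ?_
  -- The rule is the split `1 - q^(N+1) = (1 - q^(N+1-m)) + q^(N+1-m) (1 - q^m)`.
  have : q ^ (N + 1) = q ^ (N + 1 - m) * q ^ m := by
    rw [← pow_add]; congr 1; have := mem_range.mp hm; omega
  rw [this]; ring

/-- The `q`-Pascal rule, second form. -/
lemma pascal_right {q : ℂ} (hq : ‖q‖ < 1) (N : ℕ) (v : ℕ → ℂ) :
    (1 - q ^ (N + 1)) * ∑ m ∈ range (N + 2), recip q (N + 1 - m) * recip q m * v m =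
      ∑ m ∈ range (N + 1), recip q (N - m) * recip q m * v (m + 1) +
      ∑ m ∈ range (N + 1), recip q (N - m) * recip q m * (q ^ m * v m) := by
  have h1 := sum_one_sub_pow_mul_recip_left hq N fun m => recip q m * (q ^ m * v m)
  have h2 := sum_one_sub_pow_mul_recip_right hq N
    fun m => recip q (N + 1 - m) * v m
  simp only [mul_assoc, Nat.add_sub_add_right] at h1 h2 ⊢
  rw [← h1, mul_sum]
  have h3 : ∑ m ∈ range (N + 1), recip q (N - m) * (recip q m * v (m + 1)) =
      ∑ m ∈ range (N + 1), recip q m * (recip q (N - m) * v (m + 1)) :=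
    sum_congr rfl fun m _ => by ring
  rw [h3, ← h2, ← sum_add_distrib]
  refine sum_congr rfl fun m hm => ?_
  -- Here the split is `1 - q^(N+1) = (1 - q^m) + q^m (1 - q^(N+1-m))`.
  have : q ^ (N + 1) = q ^ (N + 1 - m) * q ^ m := by
    rw [← pow_add]; congr 1; have := mem_range.mp hm; omega
  rw [this]; ring

/-- The finite `q`-binomial theorem. -/
lemma sum_qBinomial {q : ℂ} (hq : ‖q‖ < 1) (z : ℂ) (N : ℕ) :
    ∑ m ∈ range (N + 1), recip q (N - m) * recip q m * ((-z) ^ m * q ^ (m.choose 2)) =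
      qPoch z q N * recip q N := by
  induction N with
  | zero => simp [recip_zero, qPoch_zero]
  | succ N ih =>
    apply mul_left_cancel₀ (one_sub_pow_ne_zero hq (Nat.succ_ne_zero N))
    rw [Nat.succ_eq_add_one, pascal_left hq, ih]
    have : ∑ m ∈ range (N + 1), recip q (N - m) * recip q m *
        (q ^ (N - m) * ((-z) ^ (m + 1) * q ^ ((m + 1).choose 2))) =
        -z * q ^ N * (qPoch z q N * recip q N) := by
      rw [← ih, mul_sum]
      refine sum_congr rfl fun m hm => ?_
      rw [Nat.choose_succ_succ' m 1, Nat.choose_one_right, pow_add, pow_succ (-z)]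
      have : q ^ N = q ^ (N - m) * q ^ m := by
        rw [← pow_add]; congr 1; have := mem_range.mp hm; omega
      rw [this]; ring
    rw [this, qPoch_succ]
    linear_combination (-qPoch z q N * (1 - z * q ^ N)) * recip_succ hq N

/-- The kernel identity of the standard Bailey chain (a form of `q`-Vandermonde). -/
lemma sum_vandermonde {q : ℂ} (hq : ‖q‖ < 1) (N t : ℕ) :
    ∑ m ∈ range (N + 1), recip q (N - m) * recip q m * (q ^ (m ^ 2 + t * m) * recip q (m + t)) =
      recip q N * recip q (N + t) := by
  induction N generalizing t with
  | zero => simp [recip_zero]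
  | succ N ih =>
    apply mul_left_cancel₀ (one_sub_pow_ne_zero hq (Nat.succ_ne_zero N))
    rw [Nat.succ_eq_add_one, pascal_left hq, ih]
    -- Shifting `m` turns this sum into the induction hypothesis at `t + 1`, hence the general `t`.
    have : ∑ m ∈ range (N + 1), recip q (N - m) * recip q m *
        (q ^ (N - m) * (q ^ ((m + 1) ^ 2 + t * (m + 1)) * recip q (m + 1 + t))) =
        q ^ (N + t + 1) * (recip q N * recip q (N + (t + 1))) := by
      rw [← ih, mul_sum]
      refine sum_congr rfl fun m hm => ?_
      have h : q ^ (N - m) * q ^ ((m + 1) ^ 2 + t * (m + 1)) =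
          q ^ (N + t + 1) * q ^ (m ^ 2 + (t + 1) * m) := by
        rw [← pow_add, ← pow_add]; congr 1
        obtain ⟨d, rfl⟩ := Nat.exists_eq_add_of_le (Nat.lt_succ_iff.mp (mem_range.mp hm))
        rw [Nat.add_sub_cancel_left]; ring
      rw [show m + 1 + t = m + (t + 1) by ring]
      linear_combination (recip q (N - m) * recip q m * recip q (m + (t + 1))) * h
    rw [this, show N + 1 + t = N + t + 1 by ring, show N + (t + 1) = N + t + 1 by ring]
    linear_combination (-recip q (N + t + 1)) * recip_succ hq N -
      recip q N * recip_succ hq (N + t)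

lemma norm_sq_lt_one {q : ℂ} (hq : ‖q‖ < 1) : ‖q ^ 2‖ < 1 := norm_pow_lt_one hq two_ne_zero

/-- From `(q²;q²)_n = (q;q)_n (-q;q)_n`; it supplies the base case of both changes of base. -/
lemma qPoch_neg_mul_recip_sq {q : ℂ} (hq : ‖q‖ < 1) (n : ℕ) :
    qPoch (-q) q n * recip (q ^ 2) n = recip q n := by
  have h : qPoch (q ^ 2) (q ^ 2) n = qPoch q q n * qPoch (-q) q n := by
    simp only [qPoch, ← prod_mul_distrib]
    exact prod_congr rfl fun i _ => by ring
  have h1 := qPoch_self_ne_zero hq n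
  have h2 := qPoch_self_ne_zero (norm_sq_lt_one hq) n
  rw [h] at h2
  have h3 := right_ne_zero_of_mul h2
  rw [recip, recip, h]
  field_simp

/-- The kernel identity of the quadratic change of base `q ↦ q²` relative to `a = 1`. -/
lemma sum_changeOfBase_one {q : ℂ} (hq : ‖q‖ < 1) (hq0 : q ≠ 0) (N t : ℕ) :
    ∑ m ∈ range (N + 1), recip (q ^ 2) (N - m) * recip (q ^ 2) m *
        (qPoch (-q) q (t + 2 * m) * q ^ (N - m) * recip (q ^ 2) (m + t)) =
      recip q N * recip q (N + t) := by
  have hq2 := norm_sq_lt_one hq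
  induction N generalizing t with
  | zero => simp [recip_zero, qPoch_neg_mul_recip_sq hq]
  | succ N ih =>
    apply mul_left_cancel₀ (one_sub_pow_ne_zero hq2 (Nat.succ_ne_zero N))
    rw [Nat.succ_eq_add_one, pascal_right hq2]
    set Y : ℕ → ℂ := fun t => ∑ m ∈ range (N + 1), recip (q ^ 2) (N - m) * recip (q ^ 2) m *
        (q ^ (2 * m) * qPoch (-q) q (t + 2 * m) * q ^ (N - m) * recip (q ^ 2) (m + t)) with hY
    have h1 : ∑ m ∈ range (N + 1), recip (q ^ 2) (N - m) * recip (q ^ 2) m *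
        (qPoch (-q) q (t + 2 * (m + 1)) * q ^ (N + 1 - (m + 1)) * recip (q ^ 2) (m + 1 + t)) =
        recip q N * recip q (N + (t + 1)) + q ^ (t + 2) * Y (t + 1) := by
      rw [← ih, hY, mul_sum, ← sum_add_distrib]
      refine sum_congr rfl fun m _ => ?_
      rw [show t + 2 * (m + 1) = t + 1 + 2 * m + 1 by ring, qPoch_succ,
        Nat.add_sub_add_right, show m + 1 + t = m + (t + 1) by ring]
      ring
    have h2 : ∑ m ∈ range (N + 1), recip (q ^ 2) (N - m) * recip (q ^ 2) m *
        ((q ^ 2) ^ m * (qPoch (-q) q (t + 2 * m) * q ^ (N + 1 - m) * recip (q ^ 2) (m + t))) =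
        q * Y t := by
      rw [hY, mul_sum]
      refine sum_congr rfl fun m hm => ?_
      rw [show N + 1 - m = N - m + 1 by have := mem_range.mp hm; omega]
      ring
    -- `Y` has no evident closed form, but only `q^(t+2) Y(t+1) + q Y(t)` is needed. Comparing the
    -- induction hypotheses at `t` and `t + 1` term by term gives `q^t` times this combination.
    have h3 : recip q N * recip q (N + (t + 1)) - q ^ (2 * t + 2) * Y (t + 1) =
        recip q N * recip q (N + t) + q ^ (t + 1) * Y t := by
      rw [← ih, ← ih, hY, mul_sum, mul_sum, ← sum_add_distrib, ← sum_sub_distrib]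
      refine sum_congr rfl fun m _ => ?_
      have h := recip_succ hq2 (m + t)
      rw [show t + 1 + 2 * m = t + 2 * m + 1 by ring, qPoch_succ, ← add_assoc]
      linear_combination (recip (q ^ 2) (N - m) * recip (q ^ 2) m *
        qPoch (-q) q (t + 2 * m) * (1 + q ^ (t + 2 * m + 1)) * q ^ (N - m)) * h
    rw [h1, h2]
    apply mul_left_cancel₀ (pow_ne_zero t hq0)
    have h4 := recip_succ hq N
    have h5 := recip_succ hq (N + t)
    rw [show N + 1 + t = N + t + 1 by ring]
    rw [← add_assoc] at h3 ⊢
    linear_combination -h3 + recip q N * h5 -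
      (q ^ t * (1 + q ^ (N + 1)) * recip q (N + t + 1)) * h4

/-- The kernel identity of the quadratic change of base `q ↦ q²` relative to `a = q`. -/
lemma sum_changeOfBase_self {q : ℂ} (hq : ‖q‖ < 1) (hq0 : q ≠ 0) (N t : ℕ) :
    ∑ m ∈ range (N + 1), recip (q ^ 2) (N - m) * recip (q ^ 2) m *
        (qPoch (-q) q (t + 2 * m) * q ^ m * recip (q ^ 2) (m + t + 1)) =
      recip q N * recip q (N + t + 1) / (1 + q ^ (t + 1)) := by
  have hq2 := norm_sq_lt_one hq
  induction N generalizing t with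
  | zero =>
    have h := qPoch_neg_mul_recip_sq hq (t + 1)
    have h1 := one_add_pow_ne_zero hq (Nat.succ_ne_zero t)
    rw [Nat.succ_eq_add_one] at h1
    rw [qPoch_succ] at h
    simp only [zero_add, sum_range_one, recip_zero, Nat.sub_self, mul_zero, add_zero, pow_zero,
      one_mul, mul_one, ← h]
    field_simp
    ring
  | succ N ih =>
    apply mul_left_cancel₀ (one_sub_pow_ne_zero hq2 (Nat.succ_ne_zero N))
    rw [Nat.succ_eq_add_one, pascal_right hq2]
    set Y : ℕ → ℂ := fun t => ∑ m ∈ range (N + 1), recip (q ^ 2) (N - m) * recip (q ^ 2) m *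
        (q ^ (2 * m) * qPoch (-q) q (t + 2 * m) * q ^ m * recip (q ^ 2) (m + t + 1)) with hY
    have h1 : ∑ m ∈ range (N + 1), recip (q ^ 2) (N - m) * recip (q ^ 2) m *
        (qPoch (-q) q (t + 2 * (m + 1)) * q ^ (m + 1) * recip (q ^ 2) (m + 1 + t + 1)) =
        q * (recip q N * recip q (N + (t + 1) + 1) / (1 + q ^ (t + 1 + 1))
          + q ^ (t + 2) * Y (t + 1)) := by
      rw [← ih, hY, mul_sum, ← sum_add_distrib, mul_sum]
      refine sum_congr rfl fun m _ => ?_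
      rw [show t + 2 * (m + 1) = t + 1 + 2 * m + 1 by ring, qPoch_succ,
        show m + 1 + t = m + (t + 1) by ring]
      ring
    have h2 : ∑ m ∈ range (N + 1), recip (q ^ 2) (N - m) * recip (q ^ 2) m *
        ((q ^ 2) ^ m * (qPoch (-q) q (t + 2 * m) * q ^ m * recip (q ^ 2) (m + t + 1))) =
        Y t := by
      rw [hY]
      exact sum_congr rfl fun m hm => by ring
    -- As for `a = 1`: this determines `q^(t+1)` times the needed combination `q^(t+3) Y(t+1) +
    -- Y(t)`.
    have h3 : recip q N * recip q (N + (t + 1) + 1) / (1 + q ^ (t + 1 + 1))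
          - q ^ (2 * t + 4) * Y (t + 1) =
        recip q N * recip q (N + t + 1) / (1 + q ^ (t + 1)) + q ^ (t + 1) * Y t := by
      rw [← ih, ← ih, hY, mul_sum, mul_sum, ← sum_add_distrib, ← sum_sub_distrib]
      refine sum_congr rfl fun m _ => ?_
      have h := recip_succ hq2 (m + t + 1)
      rw [show t + 1 + 2 * m = t + 2 * m + 1 by ring, qPoch_succ, ← add_assoc]
      linear_combination (recip (q ^ 2) (N - m) * recip (q ^ 2) m *
        qPoch (-q) q (t + 2 * m) * (1 + q ^ (t + 2 * m + 1)) * q ^ m) * h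
    rw [h1, h2]
    apply mul_left_cancel₀ (pow_ne_zero (t + 1) hq0)
    have h4 := recip_succ hq N
    have h5 := recip_succ hq (N + t + 1)
    have h6 := one_add_pow_ne_zero hq (Nat.succ_ne_zero t)
    have h7 := one_add_pow_ne_zero hq (Nat.succ_ne_zero (t + 1))
    rw [Nat.succ_eq_add_one] at h6 h7
    rw [show N + 1 + t + 1 = N + t + 1 + 1 by ring]
    rw [show N + (t + 1) + 1 = N + t + 1 + 1 by ring] at h3 ⊢
    have h8 : recip q N * recip q (N + t + 1 + 1) / (1 + q ^ (t + 1 + 1)) * (1 + q ^ (t + 2)) =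
      recip q N * recip q (N + t + 1 + 1) := by field_simp
    have h9 : recip q N * recip q (N + t + 1) / (1 + q ^ (t + 1)) =
      recip q N * recip q (N + t + 1 + 1) -
      q ^ (t + 1) * ((1 + q ^ (N + 1)) * recip q N * recip q (N + t + 1 + 1)) /
        (1 + q ^ (t + 1)) := by
      field_simp
      rw [← h5]; ring
    have h10 : q ^ (t + 1) * ((1 - (q ^ 2) ^ (N + 1)) *
        (recip q (N + 1) * recip q (N + t + 1 + 1) / (1 + q ^ (t + 1)))) =
        q ^ (t + 1) * ((1 + q ^ (N + 1)) * recip q N * recip q (N + t + 1 + 1)) /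
        (1 + q ^ (t + 1)) := by
      rw [← h4]; ring
    rw [h10]
    linear_combination -h3 + h8 - h9

end RogersRamanujan

namespace RogersRamanujan

open Finset

/-! ### The Bailey kernel -/

/-- The kernel `1 / ((q;q)_{n-r} (q;q)_{n+r+e})` of a Bailey pair relative to `a = q^e`
(up to normalization). -/
noncomputable def baileyKernel (q : ℂ) (e n : ℕ) (r : ℤ) : ℂ :=
  qFactInv q (n - r) * qFactInv q (n + r + e)

lemma baileyKernel_natCast (q : ℂ) (e : ℕ) {n r : ℕ} (h : r ≤ n) :
    baileyKernel q e n r = recip q (n - r) * recip q (n + r + e) := by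
  rw [baileyKernel, qFactInv_sub_natCast q h, ← Nat.cast_add, ← Nat.cast_add, qFactInv_natCast]

lemma baileyKernel_eq_zero_of_lt (q : ℂ) (e : ℕ) {n r : ℕ} (h : n < r) :
    baileyKernel q e n r = 0 := by
  rw [baileyKernel, qFactInv_sub_natCast_of_lt q h, zero_mul]

lemma baileyKernel_neg (q : ℂ) (n : ℕ) (r : ℤ) :
    baileyKernel q 0 n (-r) = baileyKernel q 0 n r := by
  simp only [baileyKernel, Nat.cast_zero, add_zero, sub_neg_eq_add, ← sub_eq_add_neg]
  rw [mul_comm]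

lemma baileyKernel_eq_zero_of_lt_natAbs (q : ℂ) {n : ℕ} {r : ℤ} (h : n < r.natAbs) :
    baileyKernel q 0 n r = 0 := by
  obtain ⟨m, rfl | rfl⟩ := r.eq_nat_or_neg
  · exact baileyKernel_eq_zero_of_lt q 0 (by simpa using h)
  · rw [baileyKernel_neg]
    exact baileyKernel_eq_zero_of_lt q 0 (by simpa using h)

lemma sum_mul_baileyKernel_of_lt (q : ℂ) (e : ℕ) {n r : ℕ} (h : n < r) (c : ℕ → ℂ) :
    ∑ s ∈ range (n + 1), c s * baileyKernel q e s r = 0 := by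
  refine sum_eq_zero fun s hs => ?_
  rw [baileyKernel_eq_zero_of_lt q e (by have := mem_range.mp hs; omega), mul_zero]

/-- The terms with `s < r` vanish, and `s = r + m` brings the rest to the shape of the finite
summation formulas with `t = 2r + e`. -/
lemma sum_mul_baileyKernel (q : ℂ) (e r N : ℕ) (c : ℕ → ℂ) :
    ∑ s ∈ range (r + N + 1), c s * baileyKernel q e s r =
      ∑ m ∈ range (N + 1), c (r + m) * (recip q m * recip q (m + (2 * r + e))) := by
  rw [add_assoc, sum_range_add, sum_eq_zero, zero_add]
  · refine sum_congr rfl fun m _ => ?_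
    rw [baileyKernel_natCast q e (Nat.le_add_right r m), Nat.add_sub_cancel_left,
      show r + m + r + e = m + (2 * r + e) by ring]
  · intro s hs
    rw [baileyKernel_eq_zero_of_lt q e (mem_range.mp hs), mul_zero]

/-- The coefficient `q^{s²+es} / (q;q)_{n-s}` of the standard Bailey chain relative to `q^e`. -/
noncomputable def standardCoeff (q : ℂ) (e n s : ℕ) : ℂ :=
  qFactInv q ((n : ℤ) - s) * q ^ (s ^ 2 + e * s)

/-- The coefficient of the change of base `q ↦ q²` relative to `1`. -/
noncomputable def baseCoeffOne (q : ℂ) (n s : ℕ) : ℂ :=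
  qPoch (-q) q (2 * s) * qFactInv (q ^ 2) ((n : ℤ) - s) * q ^ ((n : ℤ) - s)

/-- The coefficient of the change of base `q ↦ q²` relative to `q`. -/
noncomputable def baseCoeffSelf (q : ℂ) (n s : ℕ) : ℂ :=
  qPoch (-q) q (2 * s) * qFactInv (q ^ 2) ((n : ℤ) - s) * q ^ s

lemma sum_standardCoeff_mul_baileyKernel {q : ℂ} (hq : ‖q‖ < 1) (e n r : ℕ) :
    ∑ s ∈ range (n + 1), standardCoeff q e n s * baileyKernel q e s r =
      q ^ (r ^ 2 + e * r) * baileyKernel q e n r := by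
  rcases lt_or_ge n r with h | h
  · rw [sum_mul_baileyKernel_of_lt q e h, baileyKernel_eq_zero_of_lt q e h, mul_zero]
  obtain ⟨N, rfl⟩ := Nat.exists_eq_add_of_le h
  rw [sum_mul_baileyKernel, baileyKernel_natCast q e h, Nat.add_sub_cancel_left,
    show r + N + r + e = N + (2 * r + e) by ring, ← sum_vandermonde hq, mul_sum]
  refine sum_congr rfl fun m hm => ?_
  rw [standardCoeff, qFactInv_sub_natCast q (by have := mem_range.mp hm; omega),
    Nat.add_sub_add_left, show (r + m) ^ 2 + e * (r + m) = (r ^ 2 + e * r) +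
      (m ^ 2 + (2 * r + e) * m) by ring, pow_add q (r ^ 2 + e * r)]
  ring

lemma sum_baseCoeffOne_mul_baileyKernel {q : ℂ} (hq : ‖q‖ < 1) (hq0 : q ≠ 0) (n : ℕ) (r : ℤ) :
    ∑ s ∈ range (n + 1), baseCoeffOne q n s * baileyKernel (q ^ 2) 0 s r =
      baileyKernel q 0 n r := by
  have key (r : ℕ) : ∑ s ∈ range (n + 1), baseCoeffOne q n s * baileyKernel (q ^ 2) 0 s r =
      baileyKernel q 0 n r := by
    rcases lt_or_ge n r with h | h
    · rw [sum_mul_baileyKernel_of_lt _ 0 h, baileyKernel_eq_zero_of_lt q 0 h]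
    obtain ⟨N, rfl⟩ := Nat.exists_eq_add_of_le h
    rw [sum_mul_baileyKernel, baileyKernel_natCast q 0 h, Nat.add_sub_cancel_left,
      show r + N + r + 0 = N + 2 * r by ring, ← sum_changeOfBase_one hq hq0]
    refine sum_congr rfl fun m hm => ?_
    have hm' := mem_range.mp hm
    rw [baseCoeffOne, qFactInv_sub_natCast _ (by omega), ← Nat.cast_sub (by omega), zpow_natCast,
      Nat.add_sub_add_left, mul_add, add_zero]
    ring
  obtain ⟨m, rfl | rfl⟩ := r.eq_nat_or_neg
  · exact key m
  · simpa only [baileyKernel_neg] using key m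

lemma sum_baseCoeffSelf_mul_baileyKernel {q : ℂ} (hq : ‖q‖ < 1) (hq0 : q ≠ 0) (n r : ℕ) :
    ∑ s ∈ range (n + 1), baseCoeffSelf q n s * baileyKernel (q ^ 2) 1 s r =
      q ^ r / (1 + q ^ (2 * r + 1)) * baileyKernel q 1 n r := by
  rcases lt_or_ge n r with h | h
  · rw [sum_mul_baileyKernel_of_lt _ 1 h, baileyKernel_eq_zero_of_lt q 1 h, mul_zero]
  obtain ⟨N, rfl⟩ := Nat.exists_eq_add_of_le h
  rw [sum_mul_baileyKernel, baileyKernel_natCast q 1 h, Nat.add_sub_cancel_left,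
    show r + N + r + 1 = N + 2 * r + 1 by ring, div_mul_eq_mul_div, mul_div_assoc,
    ← sum_changeOfBase_self hq hq0, mul_sum]
  refine sum_congr rfl fun m hm => ?_
  have hm' := mem_range.mp hm
  rw [baseCoeffSelf, qFactInv_sub_natCast _ (by omega), Nat.add_sub_add_left, mul_add, pow_add,
    ← add_assoc]
  ring

/-! ### Bailey pairs and their transformations -/

lemma hasSum_of_eq {ι : Type*} {f g : ι → ℂ} {a : ℂ} (h : HasSum f a) (e : ∀ r, f r = g r) :
    HasSum g a := funext e ▸ h

/-- The mechanism of every Bailey step: exchanging the finite sum over `s` with the sum over `r`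
turns the coefficients `c` acting on `β` into the factor `d` on `α`. -/
lemma hasSum_mul_sum {ι : Type*} {α d : ι → ℂ} {L : ι → ℕ → ℂ} {β c : ℕ → ℂ} {n : ℕ}
    {M : ι → ℂ} (hL : ∀ r, ∑ s ∈ range (n + 1), c s * L r s = d r * M r)
    (h : ∀ s, HasSum (fun r => α r * L r s) (β s)) :
    HasSum (fun r => α r * d r * M r) (∑ s ∈ range (n + 1), c s * β s) := by
  have := hasSum_sum (s := range (n + 1)) fun s _ => (h s).mul_left (c s)
  refine hasSum_of_eq this fun r => ?_
  rw [mul_assoc, ← hL, mul_sum]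
  exact sum_congr rfl fun s _ => by ring

lemma summable_mul_baileyKernel (q : ℂ) (α : ℤ → ℂ) (n : ℕ) :
    Summable fun r : ℤ => α r * baileyKernel q 0 n r := by
  refine summable_of_ne_finset_zero (s := Icc (-n : ℤ) n) fun r hr => ?_
  rw [baileyKernel_eq_zero_of_lt_natAbs q, mul_zero]
  rw [mem_Icc] at hr
  omega

/-- The term `(-1)^r Q^{r(r-1)/2}`. -/
noncomputable def triTerm (Q : ℂ) (r : ℤ) : ℂ := (-1) ^ r * Q ^ (r * (r - 1) / 2)

lemma triTerm_one_sub (Q : ℂ) (r : ℤ) : triTerm Q (1 - r) = -triTerm Q r := by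
  have h : (-1 : ℂ) ^ (1 - r) = -(-1) ^ r := by
    rw [zpow_sub₀ (by norm_num), zpow_one, div_eq_mul_inv, ← inv_zpow]; norm_num
  rw [triTerm, triTerm, h, show (1 - r) * (1 - r - 1) = r * (r - 1) by ring, neg_mul]

lemma mul_sub_one_div_two_neg (r : ℤ) : -r * (-r - 1) / 2 = r * (r - 1) / 2 + r := by
  rw [← Int.add_mul_ediv_right _ _ two_ne_zero]; congr 1; ring

lemma triTerm_neg {Q : ℂ} (hQ : Q ≠ 0) (r : ℤ) : triTerm Q (-r) = triTerm Q r * Q ^ r := by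
  have h : (-1 : ℂ) ^ (-r) = (-1) ^ r := by rw [zpow_neg, ← inv_zpow]; norm_num
  rw [triTerm, triTerm, h, mul_sub_one_div_two_neg, zpow_add₀ hQ, mul_assoc]

/-- The factor `1 - q^(n+r)` reduces the kernel to `1 / ((q;q)_{n-r} (q;q)_{n+r-1})`, which is
invariant under `r ↦ 1 - r`, while `triTerm` changes sign. The base `Q` is unrelated to `q`. -/
lemma hasSum_triTerm_mul_one_sub {q : ℂ} (hq : ‖q‖ < 1) (Q : ℂ) (n : ℕ) :
    HasSum (fun r : ℤ => triTerm Q r * (1 - q ^ ((n : ℤ) + r)) * baileyKernel q 0 n r) 0 := by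
  have hs := summable_mul_baileyKernel q (fun r => triTerm Q r * (1 - q ^ ((n : ℤ) + r))) n
  have h1 := hs.hasSum
  have h2 := (Equiv.subLeft (1 : ℤ)).hasSum_iff.mpr h1
  have h3 : (fun r : ℤ => triTerm Q r * (1 - q ^ ((n : ℤ) + r)) * baileyKernel q 0 n r) ∘
      (Equiv.subLeft (1 : ℤ)) =
      fun r => -(triTerm Q r * (1 - q ^ ((n : ℤ) + r)) * baileyKernel q 0 n r) := by
    funext r
    simp only [Function.comp_apply, Equiv.subLeft_apply, baileyKernel, triTerm_one_sub,
      Nat.cast_zero, add_zero]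
    have e1 := one_sub_zpow_mul_qFactInv hq ((n : ℤ) + r)
    have e2 := one_sub_zpow_mul_qFactInv hq ((n : ℤ) + (1 - r))
    rw [show (n : ℤ) + (1 - r) - 1 = n - r by ring] at e2
    rw [show (n : ℤ) - (1 - r) = n + r - 1 by ring]
    linear_combination (-triTerm Q r * qFactInv q ((n : ℤ) + r - 1)) * e2 +
      (triTerm Q r * qFactInv q ((n : ℤ) - r)) * e1
  rw [h3] at h2
  rwa [self_eq_neg.mp (h2.unique h1.neg)] at h1

/-- Multiplying the `β_n` of a pair with `α_r = (-1)^r Q^{r(r-1)/2}` by `q^{-n}` amounts to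
multiplying `α_r` by `q^r`. -/
lemma hasSum_triTerm_twist {q : ℂ} (hq : ‖q‖ < 1) (hq0 : q ≠ 0) {Q : ℂ} {n : ℕ} {b : ℂ}
    (h : HasSum (fun r : ℤ => triTerm Q r * baileyKernel q 0 n r) b) :
    HasSum (fun r : ℤ => triTerm Q r * q ^ r * baileyKernel q 0 n r) (b * q ^ (-(n : ℤ))) := by
  have h1 := (h.mul_left (q ^ (-(n : ℤ)))).sub
    ((hasSum_triTerm_mul_one_sub hq Q n).mul_left (q ^ (-(n : ℤ))))
  rw [mul_zero, sub_zero, mul_comm] at h1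
  refine hasSum_of_eq h1 fun r => ?_
  have h2 : q ^ (-(n : ℤ)) * q ^ ((n : ℤ) + r) = q ^ r := by
    rw [← zpow_add₀ hq0]; congr 1; ring
  linear_combination (triTerm Q r * baileyKernel q 0 n r) * h2

/-- The unit Bailey pair relative to `1`. -/
lemma hasSum_unit_one {q : ℂ} (hq : ‖q‖ < 1) (hq0 : q ≠ 0) (n : ℕ) :
    HasSum (fun r : ℤ => triTerm q r * baileyKernel q 0 n r) (if n = 0 then 1 else 0) := by
  split_ifs with hn
  · subst hn
    convert hasSum_single (0 : ℤ) fun r hr => ?_ using 1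
    · simp [triTerm, baileyKernel, qFactInv, qPoch]
    · rw [baileyKernel_eq_zero_of_lt_natAbs q (by omega), mul_zero]
  -- For `n > 0`, inserting `q^r` multiplies the sum by `q^(-n)` by the twist, yet leaves it
  -- unchanged by the reflection `r ↦ -r`. Since `q^(-n) ≠ 1`, the sum is zero.
  · have h1 := (summable_mul_baileyKernel q (triTerm q) n).hasSum
    have h2 := hasSum_triTerm_twist hq hq0 h1
    have h3 := (Equiv.neg ℤ).hasSum_iff.mpr h1
    have h4 : (fun r : ℤ => triTerm q r * baileyKernel q 0 n r) ∘ (Equiv.neg ℤ) =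
        fun r => triTerm q r * q ^ r * baileyKernel q 0 n r := by
      funext r
      simp [baileyKernel_neg, triTerm_neg hq0]
    rw [h4] at h3
    have h5 := h2.unique h3
    have h6 : q ^ (-(n : ℤ)) ≠ 1 := by
      rw [zpow_neg, zpow_natCast, ne_eq, inv_eq_one]
      exact fun h => one_sub_pow_ne_zero hq hn (by rw [h, sub_self])
    rcases eq_or_ne (∑' r : ℤ, triTerm q r * baileyKernel q 0 n r) 0 with h7 | h7
    · rwa [h7] at h1
    · exact absurd ((mul_eq_left₀ h7).mp h5) h6

/-- The unit Bailey pair relative to `q`. -/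
lemma hasSum_unit_self {q : ℂ} (hq : ‖q‖ < 1) (hq0 : q ≠ 0) (n : ℕ) :
    HasSum (fun r : ℕ => triTerm q r * (1 - q ^ (2 * r + 1)) * baileyKernel q 1 n r)
      (if n = 0 then 1 else 0) := by
  have h1 := hasSum_unit_one hq hq0 n
  have hf : HasSum (fun r : ℕ => triTerm q r * (1 - q ^ (2 * r + 1)) * baileyKernel q 1 n r)
      (∑' r : ℕ, triTerm q r * (1 - q ^ (2 * r + 1)) * baileyKernel q 1 n r) := by
    refine (summable_of_ne_finset_zero (s := range (n + 1)) fun r hr => ?_).hasSum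
    rw [baileyKernel_eq_zero_of_lt q 1 (by simpa [Nat.succ_le_iff] using hr), mul_zero]
  -- Fold the bilateral unit pair, joining `r` with `-(r+1)`; the two kernels relative to `1`
  -- combine into `1 - q^(2r+1)` times the kernel relative to `q`.
  have h2 := h1.nat_add_neg_add_one
  convert h2 using 2 with r
  have h3 : triTerm q (-((r : ℤ) + 1)) = -triTerm q r * q ^ (2 * r + 1) := by
    rw [triTerm_neg hq0, show (r : ℤ) + 1 = 1 - (-r) by ring, triTerm_one_sub, triTerm_neg hq0,
      neg_mul, neg_mul, mul_assoc, ← zpow_add₀ hq0, ← zpow_natCast]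
    congr 3
    push_cast
    ring
  rw [baileyKernel_neg, h3]
  have e1 := one_sub_zpow_mul_qFactInv hq ((n : ℤ) + r + 1)
  have e2 := one_sub_zpow_mul_qFactInv hq ((n : ℤ) - r)
  have e3 : q ^ ((2 * r + 1 : ℕ) : ℤ) * q ^ ((n : ℤ) - r) = q ^ ((n : ℤ) + r + 1) := by
    rw [← zpow_add₀ hq0]; congr 1; push_cast; ring
  rw [zpow_natCast] at e3
  rw [show (n : ℤ) + r + 1 - 1 = n + r by ring] at e1
  simp only [baileyKernel, Nat.cast_zero, add_zero, Nat.cast_one]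
  rw [show (n : ℤ) - (r + 1) = n - r - 1 by ring, ← add_assoc, ← e1, ← e2]
  linear_combination (-triTerm q r * qFactInv q ((n : ℤ) - r) * qFactInv q ((n : ℤ) + r + 1)) * e3

/-- The iterated sum `∑ g₀(n, m₁) g₁(m₁, m₂) ⋯ g_{K-1}(m_{K-1}, 0)`. -/
noncomputable def chainSum : ℕ → (ℕ → ℕ → ℕ → ℂ) → ℕ → ℂ
  | 0, _, n => if n = 0 then 1 else 0
  | K + 1, g, n => ∑ m ∈ range (n + 1), g 0 n m * chainSum K (fun i => g (i + 1)) m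

lemma pow_two_pow_succ (q : ℂ) (i : ℕ) : q ^ 2 ^ (i + 1) = (q ^ 2) ^ 2 ^ i := by
  rw [← pow_mul]; congr 1; ring

/-- The coefficients of the chain of changes of base relative to `1`, twisted at step `J - 1`. -/
noncomputable def twistedCoeff (q : ℂ) (J i n m : ℕ) : ℂ :=
  baseCoeffOne (q ^ 2 ^ i) n m * if i + 1 = J then (q ^ 2 ^ J) ^ (-(m : ℤ)) else 1

/-- The unit pair in base `q ^ 2 ^ K` is carried down to base `q` with `α` unchanged; the induction
replaces `q` by `q²`. -/
lemma hasSum_chainSum_baseCoeffOne (K : ℕ) {q : ℂ} (hq : ‖q‖ < 1) (hq0 : q ≠ 0) (n : ℕ) :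
    HasSum (fun r : ℤ => triTerm (q ^ 2 ^ K) r * baileyKernel q 0 n r)
      (chainSum K (fun i => baseCoeffOne (q ^ 2 ^ i)) n) := by
  induction K generalizing q n with
  | zero => simpa [chainSum] using hasSum_unit_one hq hq0 n
  | succ K ih =>
    have h := hasSum_mul_sum (c := baseCoeffOne q n) (d := 1) (M := baileyKernel q 0 n)
      (fun r => by rw [Pi.one_apply, one_mul]; exact sum_baseCoeffOne_mul_baileyKernel hq hq0 n r)
      fun s => ih (norm_sq_lt_one hq) (pow_ne_zero 2 hq0) s
    simpa [chainSum, pow_two_pow_succ] using h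

/-- On reaching base `q ^ 2 ^ J`, `α` is still a `triTerm`, so the twist applies there, and the
remaining `J` steps carry the new factor along. For `J = 0` the twist follows the whole chain and
cannot be absorbed in a coefficient. -/
lemma hasSum_chainSum_twistedCoeff {K J : ℕ} (hJ : J ≤ K) {q : ℂ} (hq : ‖q‖ < 1) (hq0 : q ≠ 0)
    (n : ℕ) :
    HasSum (fun r : ℤ => triTerm (q ^ 2 ^ K) r * (q ^ 2 ^ J) ^ r * baileyKernel q 0 n r)
      (chainSum K (twistedCoeff q J) n * if J = 0 then q ^ (-(n : ℤ)) else 1) := by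
  induction J generalizing K q n with
  | zero =>
    have h := hasSum_triTerm_twist hq hq0 (hasSum_chainSum_baseCoeffOne K hq hq0 n)
    have e : twistedCoeff q 0 = fun i => baseCoeffOne (q ^ 2 ^ i) := by
      funext i n m
      simp [twistedCoeff]
    simpa [e] using h
  | succ J ih =>
    obtain ⟨K, rfl⟩ : ∃ K', K = K' + 1 := ⟨K - 1, by omega⟩
    have h := hasSum_mul_sum (c := baseCoeffOne q n) (d := 1) (M := baileyKernel q 0 n)
      (fun r => by rw [Pi.one_apply, one_mul]; exact sum_baseCoeffOne_mul_baileyKernel hq hq0 n r)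
      fun s => ih (Nat.le_of_succ_le_succ hJ) (norm_sq_lt_one hq) (pow_ne_zero 2 hq0) s
    simp only [Pi.one_apply, mul_one, ← pow_two_pow_succ] at h
    simp only [Nat.add_eq_zero_iff, one_ne_zero, and_false, if_false, mul_one, chainSum]
    convert h using 2 with m
    have e : (fun i => twistedCoeff q (J + 1) (i + 1)) = twistedCoeff (q ^ 2) J := by
      funext i n m
      simp [twistedCoeff, pow_two_pow_succ]
    rw [e]
    by_cases hJ0 : J = 0
    · simp [twistedCoeff, hJ0]; ring
    · simp [twistedCoeff, hJ0]

/-- The step factors `q^r / (1 + q^(2r+1))` telescope: each denominator halves the exponent in `1 -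
(q²)^(2r+1)`, and the numerators collect `1 + 2 + ⋯ + 2^(K-1) = 2^K - 1` in the exponent. -/
lemma hasSum_chainSum_baseCoeffSelf (K : ℕ) {q : ℂ} (hq : ‖q‖ < 1) (hq0 : q ≠ 0) (n : ℕ) :
    HasSum (fun r : ℕ => triTerm (q ^ 2 ^ K) r * q ^ ((2 ^ K - 1) * r) *
        (1 - q ^ (2 * r + 1)) * baileyKernel q 1 n r)
      (chainSum K (fun i => baseCoeffSelf (q ^ 2 ^ i)) n) := by
  induction K generalizing q n with
  | zero => simpa [chainSum] using hasSum_unit_self hq hq0 n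
  | succ K ih =>
    have h := hasSum_mul_sum (c := baseCoeffSelf q n)
      (fun r => sum_baseCoeffSelf_mul_baileyKernel hq hq0 n r)
      fun s => ih (norm_sq_lt_one hq) (pow_ne_zero 2 hq0) s
    simp only [← pow_two_pow_succ] at h
    simp only [chainSum, pow_zero, pow_one]
    refine hasSum_of_eq h fun r => ?_
    have h1 := one_add_pow_ne_zero hq (Nat.succ_ne_zero (2 * r))
    rw [Nat.succ_eq_add_one] at h1
    have h2 : q ^ ((2 ^ (K + 1) - 1) * r) = (q ^ 2) ^ ((2 ^ K - 1) * r) * q ^ r := by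
      rw [← pow_mul, ← pow_add]
      congr 1
      obtain ⟨a, ha⟩ : ∃ a, 2 ^ K = a + 1 := ⟨2 ^ K - 1, by have := Nat.one_le_two_pow (n := K); omega⟩
      rw [pow_succ, ha, show (a + 1) * 2 - 1 = 2 * a + 1 by omega, Nat.add_sub_cancel]
      ring
    have h3 : (1 - (q ^ 2) ^ (2 * r + 1)) / (1 + q ^ (2 * r + 1)) = 1 - q ^ (2 * r + 1) := by
      field_simp; ring
    rw [h2, ← h3]
    ring

end RogersRamanujan

namespace RogersRamanujan

open Finset Filter Topology

/-! ### Infinite products and limits -/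

lemma summable_norm_mul_pow (a : ℂ) {q : ℂ} (hq : ‖q‖ < 1) :
    Summable fun i : ℕ => ‖-(a * q ^ i)‖ := by
  simp only [norm_neg, norm_mul, norm_pow]
  exact (summable_geometric_of_lt_one (norm_nonneg _) hq).mul_left _

lemma multipliable_qPochInf (a : ℂ) {q : ℂ} (hq : ‖q‖ < 1) :
    Multipliable fun i : ℕ => 1 - a * q ^ i := by
  simpa only [sub_eq_add_neg] using multipliable_one_add_of_summable (summable_norm_mul_pow a hq)

lemma tendsto_qPoch (a : ℂ) {q : ℂ} (hq : ‖q‖ < 1) :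
    Tendsto (qPoch a q) atTop (𝓝 (qPochInf a q)) :=
  (multipliable_qPochInf a hq).hasProd.tendsto_prod_nat

lemma qPochInf_ne_zero {a q : ℂ} (hq : ‖q‖ < 1) (h : ∀ i : ℕ, 1 - a * q ^ i ≠ 0) :
    qPochInf a q ≠ 0 := by
  have := tprod_one_add_ne_zero_of_summable (f := fun i : ℕ => -(a * q ^ i))
    (fun i => by simpa only [← sub_eq_add_neg] using h i) (summable_norm_mul_pow a hq)
  simpa only [← sub_eq_add_neg, qPochInf] using this

lemma qPochInf_self_ne_zero {q : ℂ} (hq : ‖q‖ < 1) : qPochInf q q ≠ 0 :=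
  qPochInf_ne_zero hq fun i => by
    rw [← pow_succ']; exact one_sub_pow_ne_zero hq (Nat.succ_ne_zero i)

lemma tendsto_recip {q : ℂ} (hq : ‖q‖ < 1) :
    Tendsto (recip q) atTop (𝓝 (qPochInf q q)⁻¹) :=
  (tendsto_qPoch q hq).inv₀ (qPochInf_self_ne_zero hq)

lemma exists_norm_le_of_tendsto {u : ℕ → ℂ} {l : ℂ} (h : Tendsto u atTop (𝓝 l)) :
    ∃ C, 0 ≤ C ∧ ∀ n, ‖u n‖ ≤ C := by
  obtain ⟨C, hC⟩ := (Metric.isBounded_range_of_tendsto u h).exists_norm_le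
  exact ⟨C, (norm_nonneg _).trans (hC (u 0) ⟨0, rfl⟩), fun n => hC _ ⟨n, rfl⟩⟩

lemma exists_norm_qFactInv_le {q : ℂ} (hq : ‖q‖ < 1) :
    ∃ C, 0 ≤ C ∧ ∀ m : ℤ, ‖qFactInv q m‖ ≤ C := by
  obtain ⟨C, hC, h⟩ := exists_norm_le_of_tendsto (tendsto_recip hq)
  refine ⟨C, hC, fun m => ?_⟩
  rcases lt_or_ge m 0 with hm | hm
  · rw [qFactInv_of_neg q hm, norm_zero]; exact hC
  · lift m to ℕ using hm
    rw [qFactInv_natCast]; exact h m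

lemma tendsto_qFactInv_add {q : ℂ} (hq : ‖q‖ < 1) (r : ℤ) :
    Tendsto (fun n : ℕ => qFactInv q (n + r)) atTop (𝓝 (qPochInf q q)⁻¹) := by
  have h1 : Tendsto (fun n : ℕ => ((n : ℤ) + r).toNat) atTop atTop := by
    refine tendsto_atTop.mpr fun b => ?_
    filter_upwards [eventually_ge_atTop (b + r.natAbs)] with n hn
    omega
  refine ((tendsto_recip hq).comp h1).congr' ?_
  filter_upwards [eventually_ge_atTop r.natAbs] with n hn
  rw [Function.comp_apply, ← qFactInv_natCast, Int.toNat_of_nonneg (by omega)]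

lemma tendsto_baileyKernel {q : ℂ} (hq : ‖q‖ < 1) (e : ℕ) (r : ℤ) :
    Tendsto (fun n => baileyKernel q e n r) atTop (𝓝 ((qPochInf q q)⁻¹ * (qPochInf q q)⁻¹)) := by
  simp only [baileyKernel, sub_eq_add_neg, add_assoc]
  exact (tendsto_qFactInv_add hq _).mul (tendsto_qFactInv_add hq _)

/-- If `∑ A_r / ((q;q)_{n-r} (q;q)_{n+r+e}) = γ_n`, then `γ_n → (∑ A_r) / (q;q)_∞²`. -/
lemma tendsto_of_hasSum_baileyKernel {ι : Type*} {q : ℂ} (hq : ‖q‖ < 1) {e : ℕ} {φ : ι → ℤ}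
    {A : ι → ℂ} {a : ℂ} {γ : ℕ → ℂ} (hA : HasSum A a)
    (hγ : ∀ n, HasSum (fun r => A r * baileyKernel q e n (φ r)) (γ n)) :
    Tendsto γ atTop (𝓝 (a * ((qPochInf q q)⁻¹ * (qPochInf q q)⁻¹))) := by
  obtain ⟨C, hC, hb⟩ := exists_norm_qFactInv_le hq
  have h := tendsto_tsum_of_dominated_convergence (𝓕 := atTop)
    (f := fun n r => A r * baileyKernel q e n (φ r)) (bound := fun r => ‖A r‖ * (C * C))
    (hA.summable.norm.mul_right _) (fun r => (tendsto_baileyKernel hq e (φ r)).const_mul (A r))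
    (Eventually.of_forall fun n r => by
      rw [norm_mul, baileyKernel, norm_mul]
      gcongr
      · exact hb _
      · exact hb _)
  rw [tsum_mul_right, hA.tsum_eq] at h
  exact h.congr fun n => (hγ n).tsum_eq

/-- The limiting case of the Bailey lemma. -/
lemma tsum_pow_mul_eq {ι : Type*} {q : ℂ} (hq : ‖q‖ < 1) {e : ℕ} {φ : ι → ℤ} {A : ι → ℂ} {a : ℂ}
    {β : ℕ → ℂ} (hA : HasSum A a) (hβ : Summable fun n => q ^ (n ^ 2 + e * n) * β n)
    (hγ : ∀ n, HasSum (fun r => A r * baileyKernel q e n (φ r))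
      (∑ s ∈ range (n + 1), standardCoeff q e n s * β s)) :
    ∑' n, q ^ (n ^ 2 + e * n) * β n = a / qPochInf q q := by
  obtain ⟨C, hC, hb⟩ := exists_norm_qFactInv_le hq
  have h1 := tendsto_tsum_of_dominated_convergence (𝓕 := atTop)
    (f := fun n s : ℕ => standardCoeff q e n s * β s)
    (g := fun s => (qPochInf q q)⁻¹ * (q ^ (s ^ 2 + e * s) * β s))
    (bound := fun s => C * ‖q ^ (s ^ 2 + e * s) * β s‖)
    (hβ.norm.mul_left _) (fun s => by
      simp only [standardCoeff, sub_eq_add_neg, mul_assoc]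
      exact (tendsto_qFactInv_add hq _).mul_const _)
    (Eventually.of_forall fun n s => by
      rw [standardCoeff, mul_assoc, norm_mul]
      gcongr
      exact hb _)
  have h2 : ∀ n : ℕ, ∑' s, standardCoeff q e n s * β s =
      ∑ s ∈ range (n + 1), standardCoeff q e n s * β s := fun n =>
    tsum_eq_sum fun s hs => by
      rw [standardCoeff, qFactInv_sub_natCast_of_lt q (by simpa [Nat.succ_le_iff] using hs)]
      simp
  simp only [h2, tsum_mul_left] at h1
  -- The same sequence has a limit with one factor `1 / (q;q)_∞` from the `β` side and two from the
  -- `α` side; one cancels.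
  have h3 := tendsto_nhds_unique h1 (tendsto_of_hasSum_baileyKernel hq hA hγ)
  have h4 := qPochInf_self_ne_zero hq
  field_simp at h3 ⊢
  exact h3

/-! ### The Jacobi triple product -/

/-- Each factor is turned over by `1 - z Q^(-j) = -z Q^(-j) (1 - Q^j / z)`, for `j = 1, …, n`. -/
lemma qPoch_mul_zpow_neg {Q z : ℂ} (hQ0 : Q ≠ 0) (hz : z ≠ 0) (n : ℕ) :
    qPoch (z * Q ^ (-(n : ℤ))) Q n * ((-z⁻¹) ^ n * Q ^ ((n + 1).choose 2)) =
      qPoch (Q / z) Q n := by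
  induction n with
  | zero => simp [qPoch]
  | succ n ih =>
    rw [qPoch_succ (Q / z), ← ih, qPoch, prod_range_succ']
    have h : ∏ i ∈ range n, (1 - z * Q ^ (-((n + 1 : ℕ) : ℤ)) * Q ^ (i + 1)) =
        qPoch (z * Q ^ (-(n : ℤ))) Q n := by
      refine prod_congr rfl fun i _ => ?_
      have : Q ^ (-((n + 1 : ℕ) : ℤ)) * Q ^ (i + 1) = Q ^ (-(n : ℤ)) * Q ^ i := by
        rw [← zpow_natCast, ← zpow_natCast, ← zpow_add₀ hQ0, ← zpow_add₀ hQ0]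
        congr 1; push_cast; ring
      rw [mul_assoc, this, mul_assoc]
    rw [h, Nat.choose_succ_succ' (n + 1) 1, Nat.choose_one_right, pow_add, pow_succ (-z⁻¹),
      div_eq_mul_inv]
    have e1 : Q ^ (-((n + 1 : ℕ) : ℤ)) * Q ^ (n + 1) = 1 := by
      rw [zpow_neg, zpow_natCast, inv_mul_cancel₀ (pow_ne_zero _ hQ0)]
    linear_combination (qPoch (z * Q ^ (-(n : ℤ))) Q n * (-z⁻¹) ^ n * Q ^ ((n + 1).choose 2)) *
      (z * z⁻¹ * e1 + mul_inv_cancel₀ hz)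

lemma two_mul_choose_two (m : ℕ) : 2 * (m.choose 2 : ℤ) = m * (m - 1) := by
  induction m with
  | zero => simp
  | succ m ih =>
    rw [Nat.choose_succ_succ' m 1, Nat.choose_one_right]
    push_cast
    linear_combination ih

lemma hasSum_sum_of_eq {ι : Type*} {f g : ι → ℂ} {s : Finset ι} (h : ∀ i ∈ s, f i = g i)
    (h0 : ∀ i ∉ s, f i = 0) : HasSum f (∑ i ∈ s, g i) := by
  rw [← sum_congr rfl h]
  exact hasSum_sum_of_ne_finset_zero h0

/-- The finite form of the Jacobi triple product. -/
lemma hasSum_finite_jacobi {Q : ℂ} (hQ : ‖Q‖ < 1) (hQ0 : Q ≠ 0) {z : ℂ} (hz : z ≠ 0) (n : ℕ) :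
    HasSum (fun r : ℤ => triTerm Q r * z ^ r * baileyKernel Q 0 n r)
      (qPoch z Q n * qPoch (Q / z) Q n * recip Q (2 * n)) := by
  -- The `q`-binomial theorem of order `2n` at `z Q^(-n)`, recentred by `m = r + n`.
  have h1 := sum_qBinomial hQ (z * Q ^ (-(n : ℤ))) (2 * n)
  have h2 : qPoch (z * Q ^ (-(n : ℤ))) Q (2 * n) =
      qPoch (z * Q ^ (-(n : ℤ))) Q n * qPoch z Q n := by
    rw [two_mul, qPoch, prod_range_add]
    congr 1
    refine prod_congr rfl fun i _ => ?_
    rw [zpow_neg, zpow_natCast, pow_add]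
    field_simp
  have h3 : qPoch z Q n * qPoch (Q / z) Q n * recip Q (2 * n) =
      ∑ m ∈ range (2 * n + 1), ((-z⁻¹) ^ n * Q ^ ((n + 1).choose 2)) *
        (recip Q (2 * n - m) * recip Q m * ((-(z * Q ^ (-(n : ℤ)))) ^ m * Q ^ m.choose 2)) := by
    rw [← mul_sum, h1, h2, ← qPoch_mul_zpow_neg hQ0 hz]
    ring
  rw [← (Equiv.subRight (n : ℤ)).hasSum_iff,
    ← (Nat.cast_injective (R := ℤ)).hasSum_iff, h3]
  · refine hasSum_sum_of_eq (fun m hm => ?_) fun m hm => ?_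
    · have hm' : m ≤ 2 * n := Nat.lt_succ_iff.mp (mem_range.mp hm)
      have e1 : ((m : ℤ) - n) * (m - n - 1) / 2 =
          (m.choose 2 : ℤ) + ((n + 1).choose 2 : ℤ) + (-n * m) := by
        have a1 := two_mul_choose_two m
        have a2 := two_mul_choose_two (n + 1)
        push_cast at a2
        apply Int.ediv_eq_of_eq_mul_right two_ne_zero
        linear_combination -a1 - a2
      have e2 : baileyKernel Q 0 n ((m : ℤ) - n) = recip Q (2 * n - m) * recip Q m := by
        rw [baileyKernel, ← qFactInv_sub_natCast Q hm', ← qFactInv_natCast Q m]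
        congr 2 <;> push_cast <;> ring
      have e3 : (-1 : ℂ) ^ ((m : ℤ) - n) = (-1) ^ m * (-1) ^ n := by
        rw [zpow_sub₀ (by norm_num), zpow_natCast, zpow_natCast, div_eq_mul_inv, ← inv_pow]
        norm_num
      simp only [Function.comp_apply, Equiv.subRight_apply]
      rw [e2, triTerm, e1, e3, zpow_add₀ hQ0, zpow_add₀ hQ0, zpow_natCast, zpow_natCast,
        zpow_mul, zpow_natCast, zpow_sub₀ hz, zpow_natCast, zpow_natCast, neg_pow z⁻¹,
        neg_pow (z * _), mul_pow, inv_pow, div_eq_mul_inv]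
      ring
    · simp only [Function.comp_apply, Equiv.subRight_apply]
      rw [baileyKernel_eq_zero_of_lt_natAbs Q, mul_zero]
      rw [mem_range] at hm
      omega
  · intro x hx
    simp only [Function.comp_apply, Equiv.subRight_apply]
    rw [baileyKernel_eq_zero_of_lt_natAbs Q, mul_zero]
    have : x < 0 := by
      by_contra h
      exact hx ⟨x.toNat, by omega⟩
    omega

/-- The Jacobi triple product identity. -/
lemma jacobi_triple_product {Q : ℂ} (hQ : ‖Q‖ < 1) (hQ0 : Q ≠ 0) {z : ℂ} (hz : z ≠ 0)
    (hs : Summable fun r : ℤ => triTerm Q r * z ^ r) :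
    HasSum (fun r : ℤ => triTerm Q r * z ^ r)
      (qPochInf Q Q * qPochInf z Q * qPochInf (Q / z) Q) := by
  have h1 := tendsto_of_hasSum_baileyKernel hQ (φ := id) hs.hasSum (hasSum_finite_jacobi hQ hQ0 hz)
  have h2 := ((tendsto_qPoch z hQ).mul (tendsto_qPoch (Q / z) hQ)).mul
    ((tendsto_recip hQ).comp (tendsto_id.const_mul_atTop' two_pos))
  have h3 := tendsto_nhds_unique h1 h2
  have h4 := qPochInf_self_ne_zero hQ
  convert hs.hasSum using 1
  field_simp at h3
  rw [h3]

/-- For `r ≥ 0` the term `c r` suffices; for `r < 0`, `r(r-1)/2 ≥ -r` leaves at least `(M - c)(-r)`.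
The theta series is thus dominated by a geometric one. -/
lemma jacobi_exponent_bound {M c : ℕ} (hc : 0 < c) (hcM : c < M) (r : ℤ) :
    (r.natAbs : ℤ) ≤ M * (r * (r - 1) / 2) + c * r := by
  have hcM' : (c : ℤ) + 1 ≤ M := by exact_mod_cast hcM
  have hc' : (1 : ℤ) ≤ c := by exact_mod_cast hc
  obtain ⟨m, hm⟩ : ∃ m, r * (r - 1) = 2 * m := (Int.even_mul_pred_self r).two_dvd
  rw [hm, Int.mul_ediv_cancel_left _ two_ne_zero]
  rcases le_or_gt 0 r with h | h
  · have hm0 : 0 ≤ m := by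
      rcases h.eq_or_lt with rfl | h
      · omega
      · nlinarith
    rw [Int.natAbs_of_nonneg h]
    nlinarith [mul_nonneg (by omega : (0 : ℤ) ≤ M) hm0]
  · have hm0 : -r ≤ m := by nlinarith
    rw [Int.ofNat_natAbs_of_nonpos h.le]
    nlinarith [mul_le_mul_of_nonneg_left hm0 (by omega : (0 : ℤ) ≤ M)]

lemma triTerm_pow_mul_zpow {q : ℂ} (hq0 : q ≠ 0) (M c : ℕ) (r : ℤ) :
    triTerm (q ^ M) r * (q ^ c) ^ r = (-1) ^ r * q ^ (M * (r * (r - 1) / 2) + c * r) := by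
  rw [triTerm, ← zpow_natCast, ← zpow_mul, ← zpow_natCast q c, ← zpow_mul, mul_assoc,
    ← zpow_add₀ hq0]

lemma summable_triTerm_pow_mul_zpow {q : ℂ} (hq : ‖q‖ < 1) (hq0 : q ≠ 0) {M c : ℕ} (hc : 0 < c)
    (hcM : c < M) : Summable fun r : ℤ => triTerm (q ^ M) r * (q ^ c) ^ r := by
  have hgeo := summable_geometric_of_lt_one (norm_nonneg q) hq
  have hb : Summable fun r : ℤ => ‖q‖ ^ r.natAbs :=
    Summable.of_nat_of_neg (by simpa using hgeo) (by simpa using hgeo)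
  refine Summable.of_norm_bounded hb fun r => ?_
  rw [triTerm_pow_mul_zpow hq0, norm_mul, norm_zpow, norm_neg, norm_one, one_zpow, one_mul,
    norm_zpow, ← zpow_natCast]
  exact zpow_le_zpow_right_of_le_one₀ (norm_pos_iff.mpr hq0) hq.le
    (jacobi_exponent_bound hc hcM r)

/-- The Jacobi triple product in the form of the theorem. -/
lemma hasSum_triTerm_thetaQuotient {q : ℂ} (hq : ‖q‖ < 1) (hq0 : q ≠ 0) {M c d : ℕ} (hc : 0 < c)
    (hd : 0 < d) (hM : c + d = M) :
    HasSum (fun r : ℤ => triTerm (q ^ M) r * (q ^ c) ^ r)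
      (thetaQuotient q M c d * qPochInf q q) := by
  have h := jacobi_triple_product (norm_pow_lt_one hq (n := M) (by omega)) (pow_ne_zero _ hq0)
    (pow_ne_zero c hq0) (summable_triTerm_pow_mul_zpow hq hq0 hc (by omega))
  rw [thetaQuotient, div_mul_cancel₀ _ (qPochInf_self_ne_zero hq)]
  rwa [show q ^ M / q ^ c = q ^ d by
    rw [← hM, pow_add, mul_div_cancel_left₀ _ (pow_ne_zero _ hq0)]] at h

end RogersRamanujan

namespace RogersRamanujan

open Finset Filter Topology

/-! ### Sums over tuples -/

/-- Only finitely many slices contribute, so summability of each slice suffices without norm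
estimates. -/
lemma hasSum_prod_of_finite {γ : Type*} {f : ℕ × γ → ℂ} {b : ℕ → ℂ} {s : Finset ℕ}
    (h : ∀ m ∈ s, HasSum (fun t => f (m, t)) (b m)) (h0 : ∀ m ∉ s, ∀ t, f (m, t) = 0) :
    HasSum f (∑ m ∈ s, b m) := by
  have h1 : HasSum (fun p : ℕ × γ => ∑ m ∈ s, if p.1 = m then f p else 0) (∑ m ∈ s, b m) := by
    refine hasSum_sum fun m hm => ?_
    rw [← (Prod.mk_right_injective m).hasSum_iff]
    · simpa [Function.comp_def] using h m hm
    · rintro ⟨a, t⟩ hx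
      rw [if_neg]
      rintro rfl
      exact hx ⟨t, rfl⟩
  refine hasSum_of_eq h1 fun p => ?_
  rw [sum_ite_eq]
  split_ifs with hp
  · rfl
  · exact (h0 p.1 hp p.2).symm

/-- The product `∏ g_i(s_{i+1}, s_{i+2})` over a tuple. -/
noncomputable def tupleProd {k : ℕ} (g : ℕ → ℕ → ℕ → ℂ) (s : Fin (k + 1) → ℕ) : ℂ :=
  ∏ i ∈ range (k + 1), g i (idx s (i + 1)) (idx s (i + 2))

lemma idx_one {k : ℕ} (s : Fin (k + 1) → ℕ) : idx s 1 = s 0 := by simp [idx]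

lemma idx_cons_one {k : ℕ} (n : ℕ) (u : Fin k → ℕ) :
    idx (Fin.cons n u : Fin (k + 1) → ℕ) 1 = n := by simp [idx_one]

lemma idx_cons_add_two {k : ℕ} (n : ℕ) (u : Fin (k + 1) → ℕ) (i : ℕ) :
    idx (Fin.cons n u : Fin (k + 2) → ℕ) (i + 2) = idx u (i + 1) := by
  by_cases h : i + 1 ≤ k + 1
  · rw [idx, idx, dif_pos (by omega), dif_pos (by omega)]
    exact Fin.cons_succ (α := fun _ => ℕ) n u ⟨i, by omega⟩
  · rw [idx, idx, dif_neg (by omega), dif_neg (by omega)]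

lemma idx_of_gt {k : ℕ} (s : Fin (k + 1) → ℕ) {i : ℕ} (h : k + 1 < i) : idx s i = 0 := by
  rw [idx, dif_neg (by omega)]

lemma tupleProd_cons {k : ℕ} (g : ℕ → ℕ → ℕ → ℂ) (n : ℕ) (u : Fin (k + 1) → ℕ) :
    tupleProd g (Fin.cons n u : Fin (k + 2) → ℕ) =
      g 0 n (idx u 1) * tupleProd (fun i => g (i + 1)) u := by
  rw [tupleProd, prod_range_succ', mul_comm, idx_cons_one, idx_cons_add_two]
  simp only [tupleProd, idx_cons_add_two, zero_add]

lemma consEquiv_nat_apply {k : ℕ} (m : ℕ) (t : Fin k → ℕ) :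
    (Fin.consEquiv fun _ : Fin (k + 1) => ℕ) (m, t) = (Fin.cons m t : Fin (k + 1) → ℕ) := rfl

/-- Splitting off entries one by one unfolds `chainSum`; its final condition `n = 0` corresponds to
the convention `s_{k+2} = 0`. -/
lemma hasSum_tupleProd {k : ℕ} {g : ℕ → ℕ → ℕ → ℂ} (hg : ∀ i n m, n < m → g i n m = 0) (n : ℕ) :
    HasSum (fun t : Fin k → ℕ => tupleProd g (Fin.cons n t : Fin (k + 1) → ℕ))
      (chainSum (k + 1) g n) := by
  induction k generalizing g n with
  | zero =>
    simp [tupleProd, chainSum, idx_cons_one, idx_of_gt]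
  | succ k ih =>
    rw [← (Fin.consEquiv fun _ => ℕ).hasSum_iff, chainSum]
    refine hasSum_prod_of_finite (fun m _ => ?_) fun m hm t => ?_
    · refine hasSum_of_eq ((ih (g := fun i => g (i + 1)) (fun i => hg (i + 1)) m).mul_left
        (g 0 n m)) fun t => ?_
      rw [Function.comp_apply, consEquiv_nat_apply, tupleProd_cons, idx_cons_one]
    · rw [Function.comp_apply, consEquiv_nat_apply, tupleProd_cons, idx_cons_one,
        hg 0 n m (by simpa [Nat.succ_le_iff] using hm), zero_mul]

lemma hasSum_tuple {k : ℕ} {g : ℕ → ℕ → ℕ → ℂ} (hg : ∀ i n m, n < m → g i n m = 0) {w : ℕ → ℂ}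
    (hs : Summable fun s : Fin (k + 1) → ℕ => w (idx s 1) * tupleProd g s) :
    HasSum (fun n => w n * chainSum (k + 1) g n)
      (∑' s : Fin (k + 1) → ℕ, w (idx s 1) * tupleProd g s) := by
  have h := (Fin.consEquiv fun _ : Fin (k + 1) => ℕ).hasSum_iff.mpr hs.hasSum
  refine h.prod_fiberwise fun n => ?_
  refine hasSum_of_eq ((hasSum_tupleProd hg n).mul_left (w n)) fun t => ?_
  rw [Function.comp_apply, consEquiv_nat_apply, idx_cons_one]

lemma summable_prod_pow {y : ℝ} (hy0 : 0 ≤ y) (hy : y < 1) (k : ℕ) :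
    Summable fun s : Fin k → ℕ => ∏ i, y ^ s i := by
  induction k with
  | zero => exact (hasSum_fintype _).summable
  | succ k ih =>
    rw [← (Fin.consEquiv fun _ => ℕ).summable_iff]
    have := (summable_geometric_of_lt_one hy0 hy).mul_of_nonneg ih (fun n => pow_nonneg hy0 n)
      fun s => prod_nonneg fun i _ => pow_nonneg hy0 _
    refine this.congr fun p => ?_
    simp [Fin.prod_univ_succ]

/-- With `y = x^(1/(k+1))` and `s 0` the largest entry, `x^(s 0 ^ 2) ≤ x^(s 0) ≤ ∏ y^(s i)`, a
product of geometric series. -/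
lemma summable_of_le_pow_sq {k : ℕ} {F : (Fin (k + 1) → ℕ) → ℂ} {x C : ℝ} (hx0 : 0 ≤ x)
    (hx : x < 1) (hC : 0 ≤ C) (hF : ∀ s, ‖F s‖ ≤ C * x ^ (s 0 ^ 2))
    (h0 : ∀ s, F s ≠ 0 → ∀ i, s i ≤ s 0) : Summable F := by
  set y : ℝ := x ^ (((k + 1 : ℕ) : ℝ)⁻¹)
  have hy0 : 0 ≤ y := Real.rpow_nonneg hx0 _
  have hy : y < 1 := Real.rpow_lt_one hx0 hx (by positivity)
  have hyx : y ^ (k + 1) = x := Real.rpow_inv_natCast_pow hx0 (Nat.succ_ne_zero k)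
  refine Summable.of_norm_bounded ((summable_prod_pow hy0 hy (k + 1)).mul_left C) fun s => ?_
  by_cases hs : F s = 0
  · rw [hs, norm_zero]
    exact mul_nonneg hC (prod_nonneg fun i _ => pow_nonneg hy0 _)
  refine (hF s).trans (mul_le_mul_of_nonneg_left ?_ hC)
  calc x ^ (s 0 ^ 2) ≤ x ^ s 0 := pow_le_pow_of_le_one hx0 hx.le (Nat.le_self_pow two_ne_zero _)
    _ = ∏ _i : Fin (k + 1), y ^ s 0 := by
      rw [prod_const, card_univ, Fintype.card_fin, ← hyx, ← pow_mul, ← pow_mul, mul_comm]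
    _ ≤ ∏ i, y ^ s i := prod_le_prod (fun i _ => pow_nonneg hy0 _) fun i _ =>
      pow_le_pow_of_le_one hy0 hy.le (h0 s hs i)

/-! ### The summand -/

/-- The summand without its power of `q`. -/
noncomputable def core {k : ℕ} (q : ℂ) (s : Fin (k + 1) → ℕ) : ℂ :=
  qFactInv q ((idx s 1 : ℤ) - (idx s 2 : ℤ)) *
    ∏ i ∈ range k, (qPoch (-(q ^ 2 ^ i)) (q ^ 2 ^ i) (2 * idx s (i + 3)) *
      qFactInv ((q ^ 2 ^ i) ^ 2) ((idx s (i + 2) : ℤ) - (idx s (i + 3) : ℤ)))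

lemma summand_eq {k : ℕ} (q : ℂ) (e : ℤ) (s : Fin (k + 1) → ℕ) :
    summand q e s = q ^ e * core q s := by
  rw [summand, core, mul_assoc]
  congr 2
  rw [← Ico_succ_right_eq_Icc, Order.succ_eq_add_one, prod_Ico_eq_prod_range,
    show k + 2 + 1 - 3 = k by omega]
  refine prod_congr rfl fun i _ => ?_
  rw [show 3 + i - 3 = i by omega, show 3 + i - 2 = i + 1 by omega,
    show 3 + i - 1 = i + 2 by omega, add_comm 3 i, ← pow_mul, ← pow_succ]

lemma idx_le_of_core_ne_zero {k : ℕ} {q : ℂ} {s : Fin (k + 1) → ℕ} (h : core q s ≠ 0) (i : ℕ)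
    (hi : i < k + 1) : idx s (i + 2) ≤ idx s (i + 1) := by
  by_contra! hlt
  apply h
  rcases i with _ | i
  · rw [core, qFactInv_sub_natCast_of_lt q hlt, zero_mul]
  · rw [core, prod_eq_zero (mem_range.mpr (Nat.lt_of_succ_lt_succ hi)), mul_zero]
    rw [qFactInv_sub_natCast_of_lt _ hlt, mul_zero]

lemma le_zero_of_core_ne_zero {k : ℕ} {q : ℂ} {s : Fin (k + 1) → ℕ} (h : core q s ≠ 0)
    (i : Fin (k + 1)) : s i ≤ s 0 := by
  have key : ∀ i < k + 1, idx s (i + 1) ≤ idx s 1 := by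
    intro i
    induction i with
    | zero => simp
    | succ i ih => exact fun hi => (idx_le_of_core_ne_zero h i (by omega)).trans (ih (by omega))
  have := key i i.2
  rw [idx_one] at this
  simpa [idx, Nat.le_of_lt_succ i.2] using this

/-- Finite `q`-factorials and their reciprocals converge as the length grows, hence are bounded. -/
lemma exists_norm_core_le (k : ℕ) {q : ℂ} (hq : ‖q‖ < 1) :
    ∃ C, 0 ≤ C ∧ ∀ s : Fin (k + 1) → ℕ, ‖core q s‖ ≤ C := by
  obtain ⟨C, hC, h⟩ := exists_norm_qFactInv_le hq
  have hb : ∀ i : ℕ, ∃ D, 0 ≤ D ∧ ∀ (a : ℕ) (b : ℤ),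
      ‖qPoch (-(q ^ 2 ^ i)) (q ^ 2 ^ i) a * qFactInv ((q ^ 2 ^ i) ^ 2) b‖ ≤ D := by
    intro i
    have hqi : ‖q ^ 2 ^ i‖ < 1 := norm_pow_lt_one hq (by positivity)
    obtain ⟨D₁, h1, h1'⟩ := exists_norm_le_of_tendsto (tendsto_qPoch (-(q ^ 2 ^ i)) hqi)
    obtain ⟨D₂, h2, h2'⟩ := exists_norm_qFactInv_le (norm_sq_lt_one hqi)
    refine ⟨D₁ * D₂, mul_nonneg h1 h2, fun a b => ?_⟩
    rw [norm_mul]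
    exact mul_le_mul (h1' a) (h2' b) (norm_nonneg _) h1
  choose D hD hD' using hb
  refine ⟨C * ∏ i ∈ range k, D i, mul_nonneg hC (prod_nonneg fun i _ => hD i), fun s => ?_⟩
  rw [core, norm_mul, norm_prod]
  exact mul_le_mul (h _) (prod_le_prod (fun i _ => norm_nonneg _) fun i _ => hD' i _ _)
    (prod_nonneg fun i _ => norm_nonneg _) hC

lemma norm_zpow_le_of_sq_le {q : ℂ} (hq : ‖q‖ < 1) {n : ℕ} {e : ℤ} (h : (n : ℤ) ^ 2 ≤ e) :
    ‖q ^ e‖ ≤ ‖q‖ ^ (n ^ 2) := by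
  lift e to ℕ using (sq_nonneg _).trans h
  rw [zpow_natCast, norm_pow]
  exact pow_le_pow_of_le_one (norm_nonneg _) hq.le (by exact_mod_cast h)

/-- The exponent need only be controlled on nonincreasing tuples, since `core` vanishes elsewhere.
-/
lemma exists_norm_summand_le {k : ℕ} {q : ℂ} (hq : ‖q‖ < 1) {E : (Fin (k + 1) → ℕ) → ℤ}
    (hE : ∀ s, (∀ i < k + 1, idx s (i + 2) ≤ idx s (i + 1)) → (idx s 1 : ℤ) ^ 2 ≤ E s) :
    ∃ C, 0 ≤ C ∧ ∀ s, ‖summand q (E s) s‖ ≤ C * ‖q‖ ^ (s 0 ^ 2) := by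
  obtain ⟨C, hC, h⟩ := exists_norm_core_le k hq
  refine ⟨C, hC, fun s => ?_⟩
  rw [summand_eq, norm_mul, mul_comm]
  by_cases hs : core q s = 0
  · rw [hs, norm_zero, zero_mul]; positivity
  refine mul_le_mul (h s) ?_ (norm_nonneg _) hC
  have := hE s (idx_le_of_core_ne_zero hs)
  rw [idx_one] at this
  exact norm_zpow_le_of_sq_le hq this

lemma summable_summand {k : ℕ} {q : ℂ} (hq : ‖q‖ < 1) {E : (Fin (k + 1) → ℕ) → ℤ}
    (hE : ∀ s, (∀ i < k + 1, idx s (i + 2) ≤ idx s (i + 1)) → (idx s 1 : ℤ) ^ 2 ≤ E s) :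
    Summable fun s => summand q (E s) s := by
  obtain ⟨C, hC, h⟩ := exists_norm_summand_le hq hE
  refine summable_of_le_pow_sq (norm_nonneg q) hq hC h fun s hs => ?_
  rw [summand_eq] at hs
  exact le_zero_of_core_ne_zero (right_ne_zero_of_mul hs)

/-- The case `q = 0` is separate because the laws of integer powers fail there. The bound `‖q‖ ^ (s
0 ^ 2)` leaves only the zero tuple. -/
lemma hasSum_summand_zero {k : ℕ} {E : (Fin (k + 1) → ℕ) → ℤ}
    (hE : ∀ s, (∀ i < k + 1, idx s (i + 2) ≤ idx s (i + 1)) → (idx s 1 : ℤ) ^ 2 ≤ E s)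
    (hE0 : E 0 = 0) : HasSum (fun s => summand 0 (E s) s) 1 := by
  have hi (i : ℕ) : idx (0 : Fin (k + 1) → ℕ) i = 0 := by simp [idx]
  convert hasSum_single (0 : Fin (k + 1) → ℕ) fun s hs => ?_ using 1
  · rw [hE0, summand_eq, core]
    simp [hi, qFactInv, qPoch]
  · obtain ⟨C, hC, h⟩ := exists_norm_summand_le (q := 0) (by simp) hE
    by_contra hne
    have h1 := h s
    have h2 : core 0 s ≠ 0 := by
      rw [summand_eq] at hne
      exact right_ne_zero_of_mul hne
    have h3 : s 0 ≠ 0 := by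
      intro h3
      apply hs
      funext i
      have := le_zero_of_core_ne_zero h2 i
      simp only [Pi.zero_apply]
      omega
    rw [norm_zero, zero_pow (pow_ne_zero 2 h3), mul_zero] at h1
    exact hne (norm_le_zero_iff.mp h1)

lemma thetaQuotient_zero {M c d : ℕ} (hM : M ≠ 0) (hc : c ≠ 0) (hd : d ≠ 0) :
    thetaQuotient 0 M c d = 1 := by
  simp [thetaQuotient, qPochInf, hM, hc, hd]

/-! ### Exponents -/

lemma sum_exponent_eq {k : ℕ} (s : Fin (k + 1) → ℕ) :
    ∑ i ∈ Icc 3 (k + 1), 2 ^ (i - 3) * (idx s i : ℤ) =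
      ∑ i ∈ range k, 2 ^ i * (idx s (i + 3) : ℤ) := by
  rw [← Ico_succ_right_eq_Icc, Order.succ_eq_add_one, sum_Ico_eq_sum_range]
  rcases k with _ | k
  · simp
  · rw [sum_range_succ, idx_of_gt s (by omega), show k + 1 + 1 + 1 - 3 = k by omega]
    simp only [add_comm 3, Nat.add_sub_cancel, Nat.cast_zero, mul_zero, add_zero]

/-- Summation by parts, with `2^(i+1) - 2^i = 2^i`. -/
lemma sum_two_pow_mul_sub (u : ℕ → ℤ) (k : ℕ) :
    ∑ i ∈ range k, 2 ^ i * (u i - u (i + 1)) + 2 ^ k * u k =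
      u 0 + ∑ i ∈ range k, 2 ^ i * u (i + 1) := by
  induction k with
  | zero => simp
  | succ k ih =>
    rw [sum_range_succ, sum_range_succ]
    linear_combination ih

/-- The form matching the factors `q^(n-s)` of `baseCoeffOne`; `baseExponent_eq'` matches
`baseCoeffSelf`. -/
lemma baseExponent_eq {k : ℕ} (s : Fin (k + 1) → ℕ) :
    baseExponent s = (idx s 1 : ℤ) ^ 2 + (idx s 2 : ℤ) ^ 2 +
      ∑ i ∈ range k, 2 ^ i * ((idx s (i + 2) : ℤ) - idx s (i + 3)) := by
  have h := sum_two_pow_mul_sub (fun i => (idx s (i + 2) : ℤ)) k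
  rw [idx_of_gt s (by omega : k + 1 < k + 2)] at h
  rw [baseExponent, sum_exponent_eq]
  simp only [Nat.cast_zero, mul_zero, add_zero, zero_add, add_assoc, Nat.reduceAdd] at h ⊢
  rw [h]

lemma baseExponent_eq' {k : ℕ} (s : Fin (k + 1) → ℕ) :
    baseExponent s = (idx s 1 : ℤ) ^ 2 + (idx s 2 : ℤ) ^ 2 + idx s 2 +
      ∑ i ∈ range k, 2 ^ i * (idx s (i + 3) : ℤ) := by
  rw [baseExponent, sum_exponent_eq]

/-- The terms below `J` are nonnegative; from `J` on the weights are at least `2^J` and the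
differences telescope. -/
lemma two_pow_mul_le_sum {u : ℕ → ℤ} {J k : ℕ} (hJ : J ≤ k) (hu : ∀ i < k, u (i + 1) ≤ u i) :
    2 ^ J * (u J - u k) ≤ ∑ i ∈ range k, 2 ^ i * (u i - u (i + 1)) := by
  induction k, hJ using Nat.le_induction with
  | base =>
    rw [sub_self, mul_zero]
    exact sum_nonneg fun i hi =>
      mul_nonneg (by positivity) (sub_nonneg.mpr (hu i (mem_range.mp hi)))
  | succ k hk ih =>
    rw [sum_range_succ]
    have h1 := ih fun i hi => hu i (by omega)
    have h2 : (2 : ℤ) ^ J ≤ 2 ^ k := pow_le_pow_right₀ (by norm_num) hk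
    have h3 := mul_le_mul_of_nonneg_right h2 (sub_nonneg.mpr (hu k (by omega)))
    linarith

lemma sq_le_baseExponent_sub {k : ℕ} {s : Fin (k + 1) → ℕ} {J : ℕ} (hJ : J < k)
    (hs : ∀ i < k + 1, idx s (i + 2) ≤ idx s (i + 1)) :
    (idx s 1 : ℤ) ^ 2 ≤ baseExponent s - 2 ^ J * (idx s (J + 2) : ℤ) := by
  have h := two_pow_mul_le_sum (u := fun i => (idx s (i + 2) : ℤ)) hJ.le fun i hi => by
    exact_mod_cast hs (i + 1) (by omega)
  rw [idx_of_gt s (by omega : k + 1 < k + 2)] at h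
  rw [baseExponent_eq]
  simp only [Nat.cast_zero, sub_zero, add_assoc, Nat.reduceAdd] at h ⊢
  nlinarith [sq_nonneg (idx s 2 : ℤ)]

lemma sq_le_baseExponent {k : ℕ} (s : Fin (k + 1) → ℕ) : (idx s 1 : ℤ) ^ 2 ≤ baseExponent s := by
  rw [baseExponent_eq']
  have : 0 ≤ ∑ i ∈ range k, 2 ^ i * (idx s (i + 3) : ℤ) := sum_nonneg fun i _ => by positivity
  nlinarith [sq_nonneg (idx s 2 : ℤ)]

lemma baseExponent_zero (k : ℕ) : baseExponent (0 : Fin (k + 1) → ℕ) = 0 := by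
  simp [baseExponent, idx]

end RogersRamanujan

namespace RogersRamanujan

open Finset Filter Topology

/-! ### The multisums -/

/-- The sequence of coefficients `c, g₀, g₁, …`. -/
def prependCoeff (c : ℕ → ℕ → ℂ) (g : ℕ → ℕ → ℕ → ℂ) : ℕ → ℕ → ℕ → ℂ
  | 0 => c
  | i + 1 => g i

lemma tupleProd_prependCoeff {k : ℕ} (c : ℕ → ℕ → ℂ) (g : ℕ → ℕ → ℕ → ℂ) (s : Fin (k + 1) → ℕ) :
    tupleProd (prependCoeff c g) s =
      c (idx s 1) (idx s 2) * ∏ i ∈ range k, g i (idx s (i + 2)) (idx s (i + 3)) := by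
  rw [tupleProd, prod_range_succ', mul_comm]
  rfl

/-- Two standard steps, the second in its limiting form, each put a factor `d` on `α`. The weight
`t` holds a twist placed after the whole chain. -/
lemma hasSum_of_chain {k e : ℕ} {q : ℂ} (hq : ‖q‖ < 1) {ι : Type*} {φ : ι → ℤ} {α d : ι → ℂ}
    {a : ℂ} {g : ℕ → ℕ → ℕ → ℂ} (hg : ∀ i n m, n < m → g i n m = 0) {t : ℕ → ℂ}
    (hβ : ∀ n, HasSum (fun r => α r * baileyKernel q e n (φ r)) (chainSum k g n * t n))
    (hS : ∀ n r, ∑ s ∈ range (n + 1), standardCoeff q e n s * baileyKernel q e s (φ r) =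
      d r * baileyKernel q e n (φ r))
    (ha : HasSum (fun r => α r * d r * d r) a) {F : (Fin (k + 1) → ℕ) → ℂ} (hs : Summable F)
    (hF : ∀ s, F s = q ^ (idx s 1 ^ 2 + e * idx s 1) *
      tupleProd (prependCoeff (fun n m => standardCoeff q e n m * t m) g) s) :
    HasSum F (a / qPochInf q q) := by
  have hg' : ∀ i n m, n < m →
      prependCoeff (fun n m => standardCoeff q e n m * t m) g i n m = 0 := by
    intro i n m h
    rcases i with _ | i
    · simp [prependCoeff, standardCoeff, qFactInv_sub_natCast_of_lt q h]
    · exact hg i n m h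
  rw [funext hF] at hs ⊢
  have h1 := hasSum_tuple (w := fun n => q ^ (n ^ 2 + e * n)) hg' hs
  have h2 : ∀ n, chainSum (k + 1) (prependCoeff (fun n m => standardCoeff q e n m * t m) g) n =
      ∑ m ∈ range (n + 1), standardCoeff q e n m * (chainSum k g m * t m) := fun n => by
    rw [chainSum]
    exact sum_congr rfl fun m _ => by simp only [prependCoeff]; ring
  have h3 : ∀ n, HasSum (fun r => α r * d r * baileyKernel q e n (φ r))
      (chainSum (k + 1) (prependCoeff (fun n m => standardCoeff q e n m * t m) g) n) := fun n => by
    rw [h2]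
    exact hasSum_mul_sum (hS n) hβ
  have h4 := tsum_pow_mul_eq hq ha h1.summable fun n => hasSum_mul_sum (hS n) h3
  rw [← h4, h1.tsum_eq]
  exact hs.hasSum

lemma zpow_sum {ι : Type*} {q : ℂ} (hq0 : q ≠ 0) (s : Finset ι) (f : ι → ℤ) :
    q ^ (∑ i ∈ s, f i) = ∏ i ∈ s, q ^ f i := by
  classical
  induction s using Finset.induction_on with
  | empty => simp
  | insert i s hi ih => rw [sum_insert hi, prod_insert hi, zpow_add₀ hq0, ih]

lemma prod_baseCoeffOne {k : ℕ} {q : ℂ} (hq0 : q ≠ 0) (s : Fin (k + 1) → ℕ) :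
    qFactInv q ((idx s 1 : ℤ) - (idx s 2 : ℤ)) *
      ∏ i ∈ range k, baseCoeffOne (q ^ 2 ^ i) (idx s (i + 2)) (idx s (i + 3)) =
    core q s * q ^ (∑ i ∈ range k, 2 ^ i * ((idx s (i + 2) : ℤ) - idx s (i + 3))) := by
  rw [zpow_sum hq0, core, mul_assoc, ← prod_mul_distrib]
  congr 1
  refine prod_congr rfl fun i _ => ?_
  rw [baseCoeffOne, zpow_mul, show (2 ^ i : ℤ) = ((2 ^ i : ℕ) : ℤ) by push_cast; rfl, zpow_natCast]

lemma prod_baseCoeffSelf {k : ℕ} {q : ℂ} (hq0 : q ≠ 0) (s : Fin (k + 1) → ℕ) :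
    qFactInv q ((idx s 1 : ℤ) - (idx s 2 : ℤ)) *
      ∏ i ∈ range k, baseCoeffSelf (q ^ 2 ^ i) (idx s (i + 2)) (idx s (i + 3)) =
    core q s * q ^ (∑ i ∈ range k, 2 ^ i * (idx s (i + 3) : ℤ)) := by
  rw [zpow_sum hq0, core, mul_assoc, ← prod_mul_distrib]
  congr 1
  refine prod_congr rfl fun i _ => ?_
  rw [baseCoeffSelf, zpow_mul, show (2 ^ i : ℤ) = ((2 ^ i : ℕ) : ℤ) by push_cast; rfl,
    zpow_natCast, zpow_natCast]

lemma baseCoeffOne_of_lt (q : ℂ) {n m : ℕ} (h : n < m) : baseCoeffOne q n m = 0 := by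
  rw [baseCoeffOne, qFactInv_sub_natCast_of_lt _ h]; simp

lemma baseCoeffSelf_of_lt (q : ℂ) {n m : ℕ} (h : n < m) : baseCoeffSelf q n m = 0 := by
  rw [baseCoeffSelf, qFactInv_sub_natCast_of_lt _ h]; simp

lemma sum_standardCoeff_mul_baileyKernel_int {q : ℂ} (hq : ‖q‖ < 1) (n : ℕ) (r : ℤ) :
    ∑ s ∈ range (n + 1), standardCoeff q 0 n s * baileyKernel q 0 s r =
      q ^ (r ^ 2) * baileyKernel q 0 n r := by
  have key (m : ℕ) : ∑ s ∈ range (n + 1), standardCoeff q 0 n s * baileyKernel q 0 s m =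
      q ^ ((m : ℤ) ^ 2) * baileyKernel q 0 n m := by
    have h := sum_standardCoeff_mul_baileyKernel hq 0 n m
    rwa [zero_mul, add_zero, ← zpow_natCast, Nat.cast_pow] at h
  obtain ⟨m, rfl | rfl⟩ := r.eq_nat_or_neg
  · exact key m
  · simpa only [baileyKernel_neg, neg_sq] using key m

lemma two_mul_mul_sub_one_div_two (r : ℤ) : 2 * (r * (r - 1) / 2) = r * (r - 1) :=
  Int.mul_ediv_cancel' (Int.even_mul_pred_self r).two_dvd

/-- From `2r² = 4 · r(r-1)/2 + 2r`. -/
lemma triTerm_mul_sq_mul_sq {q : ℂ} (hq0 : q ≠ 0) (M c : ℕ) (r : ℤ) :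
    triTerm (q ^ M) r * (q ^ c) ^ r * q ^ (r ^ 2) * q ^ (r ^ 2) =
      triTerm (q ^ (M + 4)) r * (q ^ (c + 2)) ^ r := by
  rw [triTerm_pow_mul_zpow hq0, triTerm_pow_mul_zpow hq0, mul_assoc, mul_assoc, ← zpow_add₀ hq0,
    ← zpow_add₀ hq0]
  congr 2
  have := two_mul_mul_sub_one_div_two r
  push_cast
  linear_combination -2 * this

lemma hasSum_summand_twisted {k J : ℕ} (hJ : J < k) {q : ℂ} (hq : ‖q‖ < 1) (hq0 : q ≠ 0) :
    HasSum (fun s : Fin (k + 1) → ℕ => summand q (baseExponent s - 2 ^ J * (idx s (J + 2) : ℤ)) s)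
      (thetaQuotient q (2 ^ k + 4) (2 ^ J + 2) (2 ^ k - 2 ^ J + 2)) := by
  have hJk : 2 ^ J ≤ 2 ^ k := Nat.pow_le_pow_right two_pos hJ.le
  have ha : HasSum (fun r : ℤ => triTerm (q ^ 2 ^ k) r * (q ^ 2 ^ J) ^ r * q ^ (r ^ 2) * q ^ (r ^ 2))
      (thetaQuotient q (2 ^ k + 4) (2 ^ J + 2) (2 ^ k - 2 ^ J + 2) * qPochInf q q) :=
    hasSum_of_eq (hasSum_triTerm_thetaQuotient hq hq0 (by positivity) (by positivity) (by omega))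
      fun r => (triTerm_mul_sq_mul_sq hq0 _ _ r).symm
  have h := hasSum_of_chain hq (φ := id) (g := twistedCoeff q J)
    (fun i n m h => by rw [twistedCoeff, baseCoeffOne_of_lt _ h, zero_mul])
    (hasSum_chainSum_twistedCoeff hJ.le hq hq0) (sum_standardCoeff_mul_baileyKernel_int hq) ha
    (summable_summand hq (E := fun s => baseExponent s - 2 ^ J * (idx s (J + 2) : ℤ))
      fun s hs => sq_le_baseExponent_sub hJ hs) fun s => ?_
  · rwa [mul_div_cancel_right₀ _ (qPochInf_self_ne_zero hq)] at h
  -- The twist sits in the coefficient of index `J - 1`, whose inner variable is `s_{J+2}`, or in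
  -- `t` when `J = 0`.
  have ht : (∏ i ∈ range k, if i + 1 = J then (q ^ 2 ^ J) ^ (-(idx s (i + 3) : ℤ)) else 1) *
      (if J = 0 then q ^ (-(idx s 2 : ℤ)) else 1) = q ^ (-(2 ^ J * (idx s (J + 2) : ℤ))) := by
    rcases J with _ | J
    · simp
    · simp only [Nat.add_right_cancel_iff, prod_ite_eq', mem_range, (Nat.lt_of_succ_lt hJ),
        if_true, Nat.add_eq_zero_iff, one_ne_zero, and_false, if_false, mul_one]
      rw [← zpow_natCast, ← zpow_mul]
      congr 1
      push_cast
      ring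
  have h1 := prod_baseCoeffOne hq0 s
  simp only [tupleProd_prependCoeff, twistedCoeff, prod_mul_distrib, standardCoeff, summand_eq]
  rw [sub_eq_add_neg, zpow_add₀ hq0, ← ht, baseExponent_eq, zpow_add₀ hq0, zpow_add₀ hq0,
    zero_mul, zero_mul, add_zero, add_zero, ← zpow_natCast q (idx s 1 ^ 2),
    ← zpow_natCast q (idx s 2 ^ 2), Nat.cast_pow, Nat.cast_pow]
  linear_combination -(q ^ ((idx s 1 : ℤ) ^ 2) * q ^ ((idx s 2 : ℤ) ^ 2) *
    (∏ i ∈ range k, if i + 1 = J then (q ^ 2 ^ J) ^ (-(idx s (i + 3) : ℤ)) else 1) *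
      (if J = 0 then q ^ (-(idx s 2 : ℤ)) else 1)) * h1

lemma hasSum_summand_base {k : ℕ} {q : ℂ} (hq : ‖q‖ < 1) (hq0 : q ≠ 0) :
    HasSum (fun s : Fin (k + 1) → ℕ => summand q (baseExponent s) s)
      (thetaQuotient q (2 ^ k + 4) 2 (2 ^ k + 2)) := by
  have ha : HasSum (fun r : ℤ => triTerm (q ^ 2 ^ k) r * q ^ (r ^ 2) * q ^ (r ^ 2))
      (thetaQuotient q (2 ^ k + 4) 2 (2 ^ k + 2) * qPochInf q q) := by
    refine hasSum_of_eq (hasSum_triTerm_thetaQuotient hq hq0 (by positivity) (by positivity) (by omega))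
      fun r => ?_
    have := triTerm_mul_sq_mul_sq hq0 (2 ^ k) 0 r
    rw [pow_zero, one_zpow, mul_one, zero_add] at this
    exact this.symm
  have h := hasSum_of_chain hq (φ := id) (g := fun i => baseCoeffOne (q ^ 2 ^ i)) (t := fun _ => 1)
    (fun i n m h => baseCoeffOne_of_lt _ h)
    (fun n => by rw [mul_one]; exact hasSum_chainSum_baseCoeffOne k hq hq0 n)
    (sum_standardCoeff_mul_baileyKernel_int hq) ha
    (summable_summand hq (E := baseExponent) fun s _ => sq_le_baseExponent s) fun s => ?_
  · rwa [mul_div_cancel_right₀ _ (qPochInf_self_ne_zero hq)] at h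
  have h1 := prod_baseCoeffOne hq0 s
  simp only [tupleProd_prependCoeff, standardCoeff, summand_eq]
  rw [baseExponent_eq, zpow_add₀ hq0, zpow_add₀ hq0, zero_mul, zero_mul, add_zero, add_zero,
    ← zpow_natCast q (idx s 1 ^ 2), ← zpow_natCast q (idx s 2 ^ 2), Nat.cast_pow, Nat.cast_pow]
  linear_combination -(q ^ ((idx s 1 : ℤ) ^ 2) * q ^ ((idx s 2 : ℤ) ^ 2)) * h1

/-- The bilateral theta series with `c = 2^k + 3` folds onto `r ≥ 0`: its term at `-(r+1)` is
`-q^(2r+1)` times its term at `r`. -/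
lemma hasSum_half_theta {q : ℂ} (hq : ‖q‖ < 1) (hq0 : q ≠ 0) (k : ℕ) :
    HasSum (fun r : ℕ => triTerm (q ^ 2 ^ k) r * q ^ ((2 ^ k - 1) * r) * (1 - q ^ (2 * r + 1)) *
        q ^ (r ^ 2 + 1 * r) * q ^ (r ^ 2 + 1 * r))
      (thetaQuotient q (2 ^ k + 4) 1 (2 ^ k + 3) * qPochInf q q) := by
  have h := (hasSum_triTerm_thetaQuotient hq hq0 (M := 2 ^ k + 4) (c := 2 ^ k + 3) (d := 1)
    (by positivity) one_pos rfl).nat_add_neg_add_one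
  have hswap : thetaQuotient q (2 ^ k + 4) (2 ^ k + 3) 1 =
      thetaQuotient q (2 ^ k + 4) 1 (2 ^ k + 3) := by
    rw [thetaQuotient, thetaQuotient, mul_right_comm]
  rw [hswap] at h
  refine hasSum_of_eq h fun r => ?_
  have e0 := two_mul_mul_sub_one_div_two r
  have e1 := mul_sub_one_div_two_neg ((r : ℤ) + 1)
  have e2 : ((r : ℤ) + 1) * (r + 1 - 1) / 2 = r * (r - 1) / 2 + r := by
    rw [← mul_sub_one_div_two_neg]; congr 1; ring
  have e3 : (-1 : ℂ) ^ (-((r : ℤ) + 1)) = -(-1) ^ (r : ℤ) := by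
    rw [zpow_neg, zpow_add₀ (by norm_num), zpow_one, mul_inv, ← inv_zpow]
    norm_num
  have e4 : (((2 ^ k - 1 : ℕ) : ℤ)) = 2 ^ k - 1 := by
    rw [Nat.cast_sub Nat.one_le_two_pow]
    push_cast
    ring
  have e5 := triTerm_pow_mul_zpow hq0 (2 ^ k) (2 ^ k - 1) r
  rw [zpow_natCast (q ^ (2 ^ k - 1)), ← pow_mul, e4] at e5
  rw [triTerm_pow_mul_zpow hq0, triTerm_pow_mul_zpow hq0, e3, e1, e2, e5]
  set X : ℤ := (r : ℤ) * (r - 1) / 2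
  have e6 : q ^ (((2 ^ k + 4 : ℕ) : ℤ) * X + ((2 ^ k + 3 : ℕ) : ℤ) * r) =
      q ^ (((2 ^ k : ℕ) : ℤ) * X + (2 ^ k - 1) * r) * q ^ (r ^ 2 + 1 * r) *
        q ^ (r ^ 2 + 1 * r) := by
    rw [← zpow_natCast q (r ^ 2 + 1 * r), ← zpow_add₀ hq0, ← zpow_add₀ hq0]
    congr 1
    push_cast
    linear_combination 2 * e0
  have e7 : q ^ (((2 ^ k + 4 : ℕ) : ℤ) * (X + r + (r + 1)) +
        ((2 ^ k + 3 : ℕ) : ℤ) * -((r : ℤ) + 1)) =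
      q ^ (((2 ^ k + 4 : ℕ) : ℤ) * X + ((2 ^ k + 3 : ℕ) : ℤ) * r) * q ^ (2 * r + 1) := by
    rw [← zpow_natCast q (2 * r + 1), ← zpow_add₀ hq0]
    congr 1
    push_cast
    ring
  rw [e7, e6]
  ring

lemma hasSum_summand_linear {k : ℕ} {q : ℂ} (hq : ‖q‖ < 1) (hq0 : q ≠ 0) :
    HasSum (fun s : Fin (k + 1) → ℕ => summand q (baseExponent s + (idx s 1 : ℤ)) s)
      (thetaQuotient q (2 ^ k + 4) 1 (2 ^ k + 3)) := by
  have h := hasSum_of_chain hq (φ := fun r : ℕ => (r : ℤ))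
    (g := fun i => baseCoeffSelf (q ^ 2 ^ i)) (t := fun _ => 1)
    (fun i n m h => baseCoeffSelf_of_lt _ h)
    (fun n => by rw [mul_one]; exact hasSum_chainSum_baseCoeffSelf k hq hq0 n)
    (sum_standardCoeff_mul_baileyKernel hq 1) (hasSum_half_theta hq hq0 k)
    (summable_summand hq (E := fun s => baseExponent s + (idx s 1 : ℤ)) fun s _ =>
      (sq_le_baseExponent s).trans (by simp)) fun s => ?_
  · rwa [mul_div_cancel_right₀ _ (qPochInf_self_ne_zero hq)] at h
  have h1 := prod_baseCoeffSelf hq0 s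
  simp only [tupleProd_prependCoeff, standardCoeff, summand_eq]
  have h2 : q ^ (baseExponent s + (idx s 1 : ℤ)) = q ^ (idx s 1 ^ 2 + 1 * idx s 1) *
      q ^ (idx s 2 ^ 2 + 1 * idx s 2) * q ^ (∑ i ∈ range k, 2 ^ i * (idx s (i + 3) : ℤ)) := by
    rw [baseExponent_eq', ← zpow_natCast, ← zpow_natCast, ← zpow_add₀ hq0, ← zpow_add₀ hq0]
    congr 1
    push_cast
    ring
  rw [h2]
  linear_combination -(q ^ (idx s 1 ^ 2 + 1 * idx s 1) * q ^ (idx s 2 ^ 2 + 1 * idx s 2)) * h1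

end RogersRamanujan

namespace RogersRamanujan

open Finset Filter Topology PowerSeries
open scoped PowerSeries.WithPiTopology

/-! ### Generating functions of restricted partitions -/

/-- The factor of the generating function of partitions that accounts for the part `d`. -/
noncomputable def partSeries (d : ℕ) : PowerSeries ℝ := PowerSeries.mk fun n => if d ∣ n then 1 else 0

lemma tsum_X_pow_eq_partSeries {d : ℕ} (hd : d ≠ 0) :
    ∑' j : ℕ, (PowerSeries.X : PowerSeries ℝ) ^ (d * j) = partSeries d := by
  ext n
  have hs : Summable fun j : ℕ => (PowerSeries.X : PowerSeries ℝ) ^ (d * j) := by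
    simp_rw [pow_mul]
    exact PowerSeries.WithPiTopology.summable_pow_of_constantCoeff_eq_zero (by simp [hd])
  rw [hs.map_tsum _ (PowerSeries.WithPiTopology.continuous_coeff ℝ n), partSeries,
    PowerSeries.coeff_mk]
  simp only [PowerSeries.coeff_X_pow]
  split_ifs with h
  · obtain ⟨m, rfl⟩ := h
    rw [tsum_eq_single m fun j hj => if_neg fun h => hj (Nat.eq_of_mul_eq_mul_left
      (Nat.pos_of_ne_zero hd) h).symm, if_pos rfl]
  · convert tsum_zero with j
    exact if_neg fun hj => h ⟨j, hj⟩

/-- `f` converges absolutely at `x`, with value `v`. -/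
def EvalsTo (f : PowerSeries ℝ) (x v : ℂ) : Prop :=
  (Summable fun n => ‖((PowerSeries.coeff n f : ℝ) : ℂ) * x ^ n‖) ∧
    HasSum (fun n => ((PowerSeries.coeff n f : ℝ) : ℂ) * x ^ n) v

lemma EvalsTo.mul {f g : PowerSeries ℝ} {x v w : ℂ} (hf : EvalsTo f x v) (hg : EvalsTo g x w) :
    EvalsTo (f * g) x (v * w) := by
  have e (n : ℕ) : ∑ kl ∈ antidiagonal n, (((PowerSeries.coeff kl.1 f : ℝ) : ℂ) * x ^ kl.1) *
      (((PowerSeries.coeff kl.2 g : ℝ) : ℂ) * x ^ kl.2) =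
      ((PowerSeries.coeff n (f * g) : ℝ) : ℂ) * x ^ n := by
    rw [PowerSeries.coeff_mul, Complex.ofReal_sum, sum_mul]
    refine sum_congr rfl fun kl h => ?_
    rw [← mem_antidiagonal.mp h, pow_add]
    push_cast
    ring
  have h1 := summable_norm_sum_mul_antidiagonal_of_summable_norm hf.1 hg.1
  have h2 := tsum_mul_tsum_eq_tsum_sum_antidiagonal_of_summable_norm hf.1 hg.1
  simp only [e] at h1 h2
  refine ⟨h1, ?_⟩
  rw [hf.2.tsum_eq, hg.2.tsum_eq] at h2
  rw [h2]
  exact h1.of_norm.hasSum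

lemma evalsTo_one (x : ℂ) : EvalsTo 1 x 1 := by
  have h : HasSum (fun n => ((PowerSeries.coeff n (1 : PowerSeries ℝ) : ℝ) : ℂ) * x ^ n) 1 := by
    convert hasSum_single 0 fun n hn => ?_ using 1
    · simp
    · simp [PowerSeries.coeff_one, hn]
  exact ⟨h.summable.norm, h⟩

lemma evalsTo_partSeries {d : ℕ} (hd : d ≠ 0) {x : ℂ} (hx : ‖x‖ < 1) :
    EvalsTo (partSeries d) x (1 - x ^ d)⁻¹ := by
  have h : HasSum (fun n => ((PowerSeries.coeff n (partSeries d) : ℝ) : ℂ) * x ^ n)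
      (1 - x ^ d)⁻¹ := by
    rw [← (mul_right_injective₀ hd).hasSum_iff]
    · refine hasSum_of_eq (hasSum_geometric_of_norm_lt_one (norm_pow_lt_one hx hd)) fun n => ?_
      simp [partSeries, pow_mul]
    · intro n hn
      rw [partSeries, PowerSeries.coeff_mk, if_neg fun ⟨m, hm⟩ => hn ⟨m, hm.symm⟩]
      simp
  exact ⟨h.summable.norm, h⟩

lemma evalsTo_prod (p : ℕ → Prop) [DecidablePred p] {x : ℂ} (hx : ‖x‖ < 1) (N : ℕ) :
    EvalsTo (∏ i ∈ range N, if p (i + 1) then partSeries (i + 1) else 1) x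
      (∏ i ∈ range N, if p (i + 1) then (1 - x ^ (i + 1))⁻¹ else 1) := by
  induction N with
  | zero => simpa using evalsTo_one x
  | succ N ih =>
    rw [prod_range_succ, prod_range_succ]
    refine ih.mul ?_
    split_ifs
    · exact evalsTo_partSeries (Nat.succ_ne_zero N) hx
    · exact evalsTo_one x

lemma coeff_mul_nonneg {f g : PowerSeries ℝ} (hf : ∀ n, 0 ≤ PowerSeries.coeff n f)
    (hg : ∀ n, 0 ≤ PowerSeries.coeff n g) (n : ℕ) : 0 ≤ PowerSeries.coeff n (f * g) := by
  rw [PowerSeries.coeff_mul]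
  exact sum_nonneg fun kl _ => mul_nonneg (hf _) (hg _)

lemma coeff_le_coeff_mul {f g : PowerSeries ℝ} (hf : ∀ n, 0 ≤ PowerSeries.coeff n f)
    (hg : ∀ n, 0 ≤ PowerSeries.coeff n g) (hg0 : PowerSeries.coeff 0 g = 1) (n : ℕ) :
    PowerSeries.coeff n f ≤ PowerSeries.coeff n (f * g) := by
  rw [PowerSeries.coeff_mul]
  have h := single_le_sum (f := fun kl : ℕ × ℕ => PowerSeries.coeff kl.1 f * PowerSeries.coeff kl.2 g)
    (s := antidiagonal n) (fun kl _ => mul_nonneg (hf _) (hg _)) (a := (n, 0)) (by simp)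
  simpa [hg0] using h

/-- The coefficients of the finite Euler products are nonnegative and increase to the partition
counts. Evaluation at `‖q‖` bounds the partial sums, giving absolute convergence; dominated
convergence then identifies the value at `q`. Lengths `M * L` suffice, so products may be grouped by
full periods. -/
lemma hasSum_card_restricted (p : ℕ → Prop) [DecidablePred p] {Θ : ℂ → ℂ} {M : ℕ} (hM : 0 < M)
    (hT : ∀ x : ℂ, ‖x‖ < 1 → Tendsto (fun L => ∏ i ∈ range (M * L),
      if p (i + 1) then (1 - x ^ (i + 1))⁻¹ else 1) atTop (𝓝 (Θ x))) {q : ℂ} (hq : ‖q‖ < 1) :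
    HasSum (fun n : ℕ => ((Nat.Partition.restricted n p).card : ℂ) * q ^ n) (Θ q) := by
  set P : ℕ → PowerSeries ℝ := fun N => ∏ i ∈ range N, if p (i + 1) then partSeries (i + 1) else 1
    with hP
  have hfac0 (i n : ℕ) : 0 ≤ PowerSeries.coeff n
      (if p (i + 1) then partSeries (i + 1) else (1 : PowerSeries ℝ)) := by
    split_ifs
    · rw [partSeries, PowerSeries.coeff_mk]; split_ifs <;> norm_num
    · rw [PowerSeries.coeff_one]; split_ifs <;> norm_num
  have hfac1 (i : ℕ) : PowerSeries.coeff 0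
      (if p (i + 1) then partSeries (i + 1) else (1 : PowerSeries ℝ)) = 1 := by
    split_ifs <;> simp [partSeries]
  have hP0 (N n : ℕ) : 0 ≤ PowerSeries.coeff n (P N) := by
    induction N generalizing n with
    | zero => simp only [hP, range_zero, prod_empty, PowerSeries.coeff_one]; split_ifs <;> norm_num
    | succ N ih => simp only [hP, prod_range_succ]; exact coeff_mul_nonneg ih (hfac0 N) n
  have hmono (n : ℕ) : Monotone fun N => PowerSeries.coeff n (P N) := by
    refine monotone_nat_of_le_succ fun N => ?_
    simp only [hP, prod_range_succ]
    exact coeff_le_coeff_mul (hP0 N) (hfac0 N) (hfac1 N) n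
  have hlim (n : ℕ) : Tendsto (fun N => PowerSeries.coeff n (P N)) atTop
      (𝓝 ((Nat.Partition.restricted n p).card : ℝ)) := by
    have h := (Nat.Partition.hasProd_powerSeriesMk_card_restricted ℝ p).tendsto_prod_nat
    have h2 := (PowerSeries.WithPiTopology.tendsto_iff_coeff_tendsto _ _ _ _).mp h n
    rw [PowerSeries.coeff_mk] at h2
    refine h2.congr fun N => ?_
    rw [hP]
    congr 1
    exact prod_congr rfl fun i _ => by rw [tsum_X_pow_eq_partSeries (Nat.succ_ne_zero i)]
  have hle (N n : ℕ) : PowerSeries.coeff n (P N) ≤ (Nat.Partition.restricted n p).card :=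
    (hmono n).ge_of_tendsto (hlim n) N
  have hmul : Tendsto (fun L : ℕ => M * L) atTop atTop := tendsto_id.const_mul_atTop' hM
  have hsum : Summable fun n : ℕ => ((Nat.Partition.restricted n p).card : ℝ) * ‖q‖ ^ n := by
    have hx : ‖((‖q‖ : ℝ) : ℂ)‖ < 1 := by simpa using hq
    obtain ⟨B, hB, hB'⟩ := exists_norm_le_of_tendsto (hT _ hx)
    refine summable_of_sum_range_le (c := B) (fun n => by positivity) fun m => ?_
    have h1 : Tendsto (fun L => ∑ n ∈ range m, PowerSeries.coeff n (P (M * L)) * ‖q‖ ^ n) atTop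
        (𝓝 (∑ n ∈ range m, ((Nat.Partition.restricted n p).card : ℝ) * ‖q‖ ^ n)) :=
      tendsto_finsetSum _ fun n _ => ((hlim n).comp hmul).mul_const _
    refine le_of_tendsto h1 (Eventually.of_forall fun L => ?_)
    have h2 := (evalsTo_prod p hx (M * L)).2
    have h4 : HasSum (fun n => PowerSeries.coeff n (P (M * L)) * ‖q‖ ^ n)
        (∏ i ∈ range (M * L), if p (i + 1) then (1 - ((‖q‖ : ℝ) : ℂ) ^ (i + 1))⁻¹ else 1).re := by
      convert Complex.hasSum_re h2 using 2 with n
      rw [← Complex.ofReal_pow, ← Complex.ofReal_mul, Complex.ofReal_re]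
    have h5 := sum_le_hasSum (range m) (fun n _ => mul_nonneg (hP0 _ n) (by positivity)) h4
    exact h5.trans ((Complex.re_le_norm _).trans (hB' L))
  have hdom := tendsto_tsum_of_dominated_convergence (𝓕 := atTop)
    (f := fun L n => ((PowerSeries.coeff n (P (M * L)) : ℝ) : ℂ) * q ^ n)
    (g := fun n => ((Nat.Partition.restricted n p).card : ℂ) * q ^ n) hsum
    (fun n => by
      have := (Complex.continuous_ofReal.tendsto _).comp ((hlim n).comp hmul)
      simpa [Function.comp_def] using this.mul_const (q ^ n))
    (Eventually.of_forall fun L n => by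
      rw [norm_mul, norm_pow, Complex.norm_real, Real.norm_of_nonneg (hP0 _ n)]
      gcongr
      exact hle _ n)
  have hval := tendsto_nhds_unique hdom ((hT q hq).congr fun L =>
    ((evalsTo_prod p hq (M * L)).2.tsum_eq).symm)
  rw [← hval]
  refine (Summable.of_norm ?_).hasSum
  simpa using hsum

/-- The condition `c ≠ d` makes each exceptional residue occur once. -/
lemma prod_block {M c d : ℕ} (hc : 0 < c) (hd : 0 < d) (hM : c + d = M) (hcd : c ≠ d) (u : ℕ → ℂ) :
    ∏ j ∈ range M, (if j + 1 = c ∨ j + 1 = d ∨ j + 1 = M then u (j + 1) else 1) =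
      u M * u c * u d := by
  have h : ∀ a, 0 < a → a ≤ M → ∏ j ∈ range M, (if j + 1 = a then u (j + 1) else 1) = u a := by
    intro a ha haM
    rw [prod_eq_single (a - 1)]
    · rw [show a - 1 + 1 = a by omega, if_pos rfl]
    · exact fun j _ hj => if_neg (by omega)
    · exact fun hj => absurd (mem_range.mpr (by omega)) hj
  rw [← h M (by omega) le_rfl, ← h c hc (by omega), ← h d hd (by omega), ← prod_mul_distrib,
    ← prod_mul_distrib]
  refine prod_congr rfl fun j _ => ?_
  by_cases h1 : j + 1 = c
  · rw [if_pos (Or.inl h1), if_pos h1, if_neg (by omega), if_neg (by omega)]; ring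
  by_cases h2 : j + 1 = d
  · rw [if_pos (by omega), if_pos h2, if_neg (by omega), if_neg h1]; ring
  by_cases h3 : j + 1 = M
  · rw [if_pos (by omega), if_pos h3, if_neg h1, if_neg h2]; ring
  · rw [if_neg (by omega), if_neg h1, if_neg h2, if_neg h3]; ring

/-- The condition that `m` is congruent neither to `0` nor to `±c` modulo `M`. -/
def Avoids (M c m : ℕ) : Prop :=
  ¬ ((m : ℤ) ≡ 0 [ZMOD M]) ∧ ¬ ((m : ℤ) ≡ c [ZMOD M]) ∧ ¬ ((m : ℤ) ≡ -c [ZMOD M])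

instance (M c : ℕ) : DecidablePred (Avoids M c) := fun _ => by unfold Avoids; infer_instance

lemma not_avoids_iff {M c d : ℕ} (hc : 0 < c) (hd : 0 < d) (hM : c + d = M) (L : ℕ) {j : ℕ}
    (hj : j < M) : ¬ Avoids M c (M * L + j + 1) ↔ j + 1 = c ∨ j + 1 = d ∨ j + 1 = M := by
  have key (a : ℤ) : ((M * L + j + 1 : ℕ) : ℤ) ≡ a [ZMOD M] ↔ (M : ℤ) ∣ j + 1 - a := by
    rw [Int.modEq_comm, Int.modEq_iff_dvd]
    push_cast
    rw [show (M : ℤ) * L + j + 1 - a = M * L + (j + 1 - a) by ring]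
    exact (Int.dvd_add_right (dvd_mul_right _ _))
  -- As `1 ≤ j + 1 ≤ M`, the numbers `j + 1`, `j + 1 - c`, `j + 1 + c` all lie in this range.
  have hdvd {x : ℤ} (h1 : -(M : ℤ) < x) (h2 : x < 2 * M) : (M : ℤ) ∣ x ↔ x = 0 ∨ x = M := by
    constructor
    · rintro ⟨y, rfl⟩
      have : (0 : ℤ) < M := by omega
      have hy1 : -1 < y := by nlinarith
      have hy2 : y < 2 := by nlinarith
      obtain rfl | rfl : y = 0 ∨ y = 1 := by omega
      · simp
      · simp
    · rintro (rfl | rfl) <;> simp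
  rw [Avoids, key, key, key, hdvd (by omega) (by omega), hdvd (by omega) (by omega),
    hdvd (by omega) (by omega)]
  omega

lemma prod_not_avoids {M c d : ℕ} (hc : 0 < c) (hd : 0 < d) (hM : c + d = M) (hcd : c ≠ d) (x : ℂ)
    (L : ℕ) : ∏ i ∈ range (M * L), (if Avoids M c (i + 1) then 1 else 1 - x ^ (i + 1)) =
      qPoch (x ^ M) (x ^ M) L * qPoch (x ^ c) (x ^ M) L * qPoch (x ^ d) (x ^ M) L := by
  induction L with
  | zero => simp [qPoch]
  | succ L ih =>
    have h := prod_block hc hd hM hcd fun a => 1 - x ^ (M * L + a)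
    rw [mul_add, mul_one, prod_range_add, ih, qPoch_succ, qPoch_succ, qPoch_succ]
    have h2 : ∏ j ∈ range M, (if Avoids M c (M * L + j + 1) then 1 else 1 - x ^ (M * L + j + 1)) =
        (1 - x ^ (M * L + M)) * (1 - x ^ (M * L + c)) * (1 - x ^ (M * L + d)) := by
      rw [← h]
      refine prod_congr rfl fun j hj => ?_
      simp only [← not_avoids_iff hc hd hM L (mem_range.mp hj), ite_not, add_assoc]
    rw [h2]
    simp only [pow_add, pow_mul]
    ring

/-- Dividing the factors of the forbidden parts by `(q;q)_{ML}` leaves the Euler product over the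
allowed parts up to `ML`; then `L → ∞`. -/
lemma hasSum_countAvoiding {M c d : ℕ} (hc : 0 < c) (hd : 0 < d) (hM : c + d = M) (hcd : c ≠ d)
    {q : ℂ} (hq : ‖q‖ < 1) :
    HasSum (fun n : ℕ => (countAvoiding M c n : ℂ) * q ^ n) (thetaQuotient q M c d) := by
  have hM0 : 0 < M := by omega
  refine hasSum_card_restricted (Avoids M c) (Θ := fun x => thetaQuotient x M c d) hM0
    (fun x hx => ?_) hq
  have hxM := norm_pow_lt_one hx hM0.ne'
  have h1 := (((tendsto_qPoch (x ^ M) hxM).mul (tendsto_qPoch (x ^ c) hxM)).mul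
    (tendsto_qPoch (x ^ d) hxM)).div ((tendsto_qPoch x hx).comp
      (tendsto_id.const_mul_atTop' hM0)) (qPochInf_self_ne_zero hx)
  refine h1.congr fun L => ?_
  simp only [Pi.div_apply, Function.comp_apply, id, ← prod_not_avoids hc hd hM hcd]
  rw [qPoch, ← prod_div_distrib]
  refine prod_congr rfl fun i _ => ?_
  have h2 := one_sub_pow_ne_zero hx (Nat.succ_ne_zero i)
  rw [Nat.succ_eq_add_one] at h2
  rw [← pow_succ']
  split_ifs
  · rw [one_div]
  · exact div_self h2

end RogersRamanujan

/-! ### The three families of identities, with `q = 0` treated apart. -/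

theorem corollary4p4 (k : ℕ) (q : ℂ) (hq : ‖q‖ < 1) :
    (∀ j : ℕ, 1 ≤ j → j ≤ k →
      HasSum
        (fun s : Fin (k + 1) → ℕ =>
          RogersRamanujan.summand q
            (RogersRamanujan.baseExponent s
              - 2 ^ (j - 1) * (RogersRamanujan.idx s (j + 1) : ℤ)) s)
        (RogersRamanujan.thetaQuotient q (2 ^ k + 4) (2 ^ (j - 1) + 2) (2 ^ k - 2 ^ (j - 1) + 2))
      ∧ (j < k →
        HasSum (fun n : ℕ =>
            (RogersRamanujan.countAvoiding (2 ^ k + 4) (2 + 2 ^ (j - 1)) n : ℂ) * q ^ n)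
          (RogersRamanujan.thetaQuotient q (2 ^ k + 4) (2 ^ (j - 1) + 2)
            (2 ^ k - 2 ^ (j - 1) + 2)))) ∧
    (HasSum
        (fun s : Fin (k + 1) → ℕ =>
          RogersRamanujan.summand q (RogersRamanujan.baseExponent s) s)
        (RogersRamanujan.thetaQuotient q (2 ^ k + 4) 2 (2 ^ k + 2))
      ∧ HasSum (fun n : ℕ => (RogersRamanujan.countAvoiding (2 ^ k + 4) 2 n : ℂ) * q ^ n)
        (RogersRamanujan.thetaQuotient q (2 ^ k + 4) 2 (2 ^ k + 2))) ∧
    (HasSum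
        (fun s : Fin (k + 1) → ℕ =>
          RogersRamanujan.summand q
            (RogersRamanujan.baseExponent s + (RogersRamanujan.idx s 1 : ℤ)) s)
        (RogersRamanujan.thetaQuotient q (2 ^ k + 4) 1 (2 ^ k + 3))
      ∧ HasSum (fun n : ℕ => (RogersRamanujan.countAvoiding (2 ^ k + 4) 1 n : ℂ) * q ^ n)
        (RogersRamanujan.thetaQuotient q (2 ^ k + 4) 1 (2 ^ k + 3))) := by
  have hpow : 0 < 2 ^ k := by positivity
  refine ⟨fun j hj hjk => ⟨?_, fun hlt => ?_⟩, ⟨?_, ?_⟩, ?_, ?_⟩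
  · obtain ⟨J, rfl⟩ := Nat.exists_eq_add_of_le' hj
    rw [Nat.add_sub_cancel]
    rcases eq_or_ne q 0 with rfl | hq0
    · rw [RogersRamanujan.thetaQuotient_zero (by positivity) (by positivity) (by positivity)]
      exact RogersRamanujan.hasSum_summand_zero
        (E := fun s => RogersRamanujan.baseExponent s - 2 ^ J * (RogersRamanujan.idx s (J + 2) : ℤ))
        (fun s hs => RogersRamanujan.sq_le_baseExponent_sub hjk hs)
        (by simp [RogersRamanujan.baseExponent_zero, RogersRamanujan.idx])
    · exact RogersRamanujan.hasSum_summand_twisted hjk hq hq0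
  · have h1 : 2 ^ (j - 1) * 2 < 2 ^ k := by
      rw [← pow_succ]; exact Nat.pow_lt_pow_right one_lt_two (by omega)
    rw [add_comm 2]
    exact RogersRamanujan.hasSum_countAvoiding (by positivity) (by positivity) (by omega)
      (by omega) hq
  · rcases eq_or_ne q 0 with rfl | hq0
    · rw [RogersRamanujan.thetaQuotient_zero (by positivity) (by positivity) (by positivity)]
      exact RogersRamanujan.hasSum_summand_zero
        (fun s _ => RogersRamanujan.sq_le_baseExponent s) (RogersRamanujan.baseExponent_zero k)
    · exact RogersRamanujan.hasSum_summand_base hq hq0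
  · exact RogersRamanujan.hasSum_countAvoiding (by positivity) (by positivity) (by omega)
      (by omega) hq
  · rcases eq_or_ne q 0 with rfl | hq0
    · rw [RogersRamanujan.thetaQuotient_zero (by positivity) (by positivity) (by positivity)]
      exact RogersRamanujan.hasSum_summand_zero
        (E := fun s => RogersRamanujan.baseExponent s + (RogersRamanujan.idx s 1 : ℤ))
        (fun s _ => (RogersRamanujan.sq_le_baseExponent s).trans (by simp))
        (by simp [RogersRamanujan.baseExponent_zero, RogersRamanujan.idx])
    · exact RogersRamanujan.hasSum_summand_linear hq hq0
  · exact RogersRamanujan.hasSum_countAvoiding (by positivity) (by positivity) (by omega)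
      (by omega) hq
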